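/- Let $\mathcal X$ be an arbitrary set, $\mathcal H$ a finite-dimensional Hilbert space, $\mathcal S(\mathcal H)$ the set of density operators on $\mathcal H$, and let $W:\mathcal X\to\mathcal S(\mathcal H)$ be a classical-quantum channel. Write $\log$ for the natural logarithm, with $\log 0=-\infty$ and $\log(+\infty)=+\infty$. For $\alpha>1$ and positive definite operators $\varrho,\sigma$ on a finite-dimensional Hilbert space let $$Q_\alpha^*(\varrho\|\sigma)=\operatorname{Tr}\bigl(\varrho^{1/2}\sigma^{\frac{1-\alpha}{\alpha}}\varrho^{1/2}\bigr)^{\alpha},$$ extended to positive semidefinite operators by $Q_\alpha^*(\varrho\|\sigma)=\lim_{\varepsilon\searrow 0}Q_\alpha^*(\varrho+\varepsilon I\|\sigma+\varepsilon I)\in[0,+\infty]$, and let $$D_\alpha^*(\varrho\|\sigma)=\tfrac{1}{\alpha-1}\log Q_\alpha^*(\varrho\|\sigma)-\tfrac{1}{\alpha-1}\log\operatorname{Tr}\varrho .$$ The Rényi $\alpha$-capacity of $W$ is $$\chi_\alpha^*(W)=\sup_{P}\ \inf_{\sigma\in\mathcal S(\mathcal H)}D_\alpha^*\Bigl(\sum_x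 P(x)|x\rangle\langle x|\otimes W(x)\,\Big\|\,\sum_x P(x)|x\rangle\langle x|\otimes\sigma\Bigr),$$ where the supremum is over all finitely supported probability distributions $P$ on $\mathcal X$, and $\{|x\rangle\}_{x\in\operatorname{supp}P}$ is an orthonormal basis of an auxiliary Hilbert space. A code $\mathcal C_n=(\phi_n,D_n)$ for $n$ uses of $W$ with cardinality $|\mathcal C_n|=M_n\ge 1$ consists of an encoder $\phi_n:\{1,\dots,M_n\}\to\mathcal X^n$ and a POVM $\{D_n(k)\}_{k=1}^{M_n}$ on $\mathcal H^{\otimes n}$. With $W^{\otimes n}(x_1,\dots,x_n)=W(x_1)\otimes\cdots\otimes W(x_n)$, its average success probability is $$P_s(W^{\otimes n},\mathcal C_n)=\frac1{M_n}\sum_{k=1}^{M_n}\operatorname{Tr}\,W^{\otimes n}(\phi_n(k))\,D_n(k).$$ For $R\ge 0$, a number $r\in\mathbb R$ is $R$-achievable if there is a sequence of codes $\{\mathcal C_n\}_{n=1}^\infty$ with $$\liminf_{n\to\infty}\frac1n\log|\mathcal C_n|\ge R\qquad\text{and}\qquad\liminf_{n\to\infty}\frac1n\log P_s(W^{\otimes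 n},\mathcal C_n)\ge -r,$$ and the strong converse exponent is $sc(R,W)=\inf\{r: r\text{ is }R\text{-achievable}\}$. Then for every classical-quantum channel $W$ and every $R\ge 0$, $$sc(R,W)\ \ge\ \sup_{\alpha>1}\frac{\alpha-1}{\alpha}\bigl\{R-\chi_\alpha^*(W)\bigr\},$$ where suprema and infima are taken in $[-\infty,+\infty]$. -/

import Mathlib

noncomputable section

namespace CQ

open Filter Topology
open scoped ComplexOrder

/-- The density operators on the Hilbert space `ℂ^d`, `d` a finite index type. -/
abbrev DensityOp (d : Type*) [Fintype d] : Type _ :=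
  {ρ : Matrix d d ℂ // ρ.PosSemidef ∧ ρ.trace = 1}

/-- Classical-quantum channels with input alphabet `X` (an arbitrary type) and output `ℂ^d`. -/
abbrev Channel (X d : Type*) [Fintype d] : Type _ := X → DensityOp d

/-- Finitely supported probability mass functions on `X`. -/
abbrev FinProb (X : Type*) : Type _ :=
  {P : X →₀ ℝ // (∀ x, 0 ≤ P x) ∧ (P.sum fun _ p => p) = 1}

section Divergence

variable {d : Type*} [Fintype d] [DecidableEq d]

/-- Real powers of a positive semidefinite operator, taken on its support and defined to be `0` on
the orthocomplement of the support. -/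
def suppPow (A : Matrix d d ℂ) (p : ℝ) : Matrix d d ℂ :=
  cfc (fun x : ℝ => if x = 0 then 0 else x ^ p) A

/-- `Tr (ρ^{1/2} σ^{(1-α)/α} ρ^{1/2})^α`, for positive definite `ρ` and `σ`. -/
def sandwichedQPosDef (α : ℝ) (ρ σ : Matrix d d ℂ) : ℝ :=
  (suppPow (suppPow ρ (1 / 2) * suppPow σ ((1 - α) / α) * suppPow ρ (1 / 2)) α).trace.re

/-- `Q*_α(ρ‖σ)` for positive semidefinite `ρ` and `σ`: the limit of `Q*_α(ρ + εI‖σ + εI)` as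
`ε ↘ 0`, in `[0, ∞]`. -/
def sandwichedQ (α : ℝ) (ρ σ : Matrix d d ℂ) : ENNReal :=
  limUnder (𝓝[>] (0 : ℝ)) fun ε : ℝ =>
    ENNReal.ofReal (sandwichedQPosDef α (ρ + (ε : ℂ) • 1) (σ + (ε : ℂ) • 1))

/-- The sandwiched Rényi divergence
`D*_α(ρ‖σ) = (α-1)⁻¹ log Q*_α(ρ‖σ) - (α-1)⁻¹ log Tr ρ`, for `α ≠ 1`. -/
def sandwichedD (α : ℝ) (ρ σ : Matrix d d ℂ) : EReal :=
  ((1 / (α - 1) : ℝ) : EReal) * ENNReal.log (sandwichedQ α ρ σ)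
    - ((1 / (α - 1) : ℝ) : EReal) * ENNReal.log (ENNReal.ofReal ρ.trace.re)

end Divergence

section Capacity

variable {X d : Type*} [Fintype d] [DecidableEq d]

open scoped Kronecker

open Classical in
/-- The classical-quantum state `∑ₓ P(x) |x⟩⟨x| ⊗ W(x)`. Its auxiliary space has the orthonormal
basis `|x⟩`, `x ∈ supp P`; the other basis vectors are orthogonal to the supports of this operator
and of `P ⊗ σ` below. -/
def cqState (W : Channel X d) (P : FinProb X) :
    Matrix (P.1.support × d) (P.1.support × d) ℂ :=
  ∑ x : P.1.support, (P.1 x : ℂ) • (Matrix.single x x (1 : ℂ) ⊗ₖ (W x).1)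

open Classical in
/-- The operator `P ⊗ σ = (∑ₓ P(x) |x⟩⟨x|) ⊗ σ`. -/
def cqProd (P : FinProb X) (σ : DensityOp d) :
    Matrix (P.1.support × d) (P.1.support × d) ℂ :=
  (∑ x : P.1.support, (P.1 x : ℂ) • Matrix.single x x (1 : ℂ)) ⊗ₖ σ.1

open Classical in
/-- The generalized Holevo quantity `χ*_{α,1}(W, P)`. -/
def holevoQuantity (α : ℝ) (W : Channel X d) (P : FinProb X) : EReal :=
  ⨅ σ : DensityOp d, sandwichedD α (cqState W P) (cqProd P σ)

/-- The sandwiched Rényi capacity `χ*_α(W)`. -/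
def renyiCapacity (α : ℝ) (W : Channel X d) : EReal :=
  ⨆ P : FinProb X, holevoQuantity α W P

end Capacity

section Coding

variable {X d : Type*} [Fintype d] [DecidableEq d]

/-- The channel `W^{⊗n}`, `x₁ … xₙ ↦ W(x₁) ⊗ ⋯ ⊗ W(xₙ)`, on `(ℂ^d)^{⊗n} = ℂ^(d^n)`. -/
def channelPow (W : Channel X d) (n : ℕ) (x : Fin n → X) :
    Matrix (Fin n → d) (Fin n → d) ℂ :=
  Matrix.of fun a b => ∏ i, (W (x i)).1 (a i) (b i)

/-- A code for `n` uses of a channel: an encoder and a decoding POVM. -/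
structure Code (X d : Type*) [Fintype d] [DecidableEq d] (n : ℕ) where
  /-- The number of messages. -/
  card : ℕ
  card_pos : 0 < card
  /-- The encoder. -/
  enc : Fin card → Fin n → X
  /-- The decoder. -/
  dec : Fin card → Matrix (Fin n → d) (Fin n → d) ℂ
  dec_posSemidef : ∀ k, (dec k).PosSemidef
  dec_sum : ∑ k, dec k = 1

/-- The average error probability of a code. -/
def errorProb (W : Channel X d) {n : ℕ} (C : Code X d n) : ℝ :=
  1 - (1 / (C.card : ℝ)) * ∑ k, (channelPow W n (C.enc k) * C.dec k).trace.re

/-- The success probability of a code. -/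
def successProb (W : Channel X d) {n : ℕ} (C : Code X d n) : ℝ :=
  1 - errorProb W C

/-- `r` is `R`-achievable: there are codes `C n` with `liminf (1/n) log |C n| ≥ R` and
`liminf (1/n) log P_s ≥ -r`, where `log 0 = -∞`. (The term `n = 0`, for which a code always exists,
does not influence the lower limits.) -/
def IsAchievable (W : Channel X d) (R r : ℝ) : Prop :=
  ∃ C : (n : ℕ) → Code X d n,
    (R : EReal) ≤ liminf (fun n : ℕ =>
      ((1 / (n : ℝ) : ℝ) : EReal) * ENNReal.log ((C n).card : ENNReal)) atTop ∧
    ((-r : ℝ) : EReal) ≤ liminf (fun n : ℕ =>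
      ((1 / (n : ℝ) : ℝ) : EReal) * ENNReal.log (ENNReal.ofReal (successProb W (C n)))) atTop

/-- The strong converse exponent `sc(R, W)`, in the extended reals. -/
def strongConverseExponent (R : ℝ) (W : Channel X d) : EReal :=
  ⨅ (r : ℝ) (_ : IsAchievable W R r), (r : EReal)

end Coding

end CQ

end

/-!
Fix `α > 1` and write `p = (α - 1) / α`. The exponent is bounded by comparing all output states of
the channel with one reference operator.

*One shot.* For a state `ρ`, a positive definite `τ` and a test `0 ≤ D ≤ 1`,
`Tr ρD ≤ Q*_α(ρ‖τ)^{1/α} (Tr τD)^p` (`trace_mul_effect_le`). This is Hölder's inequality for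
`Tr (τ^{-p/2} ρ τ^{-p/2}) (τ^{p/2} D τ^{p/2})`; the norm of the second factor is estimated by the
trace Jensen inequality for the contraction `D^{1/2}` (`trace_cfc_conj_le`). All the trace
inequalities come from scalar Jensen inequalities in eigenbases (`map_quad_le`).

*Codes.* If `Q*_α(W(x)‖τ) ≤ L` for all `x`, then multiplicativity of `Q*_α` on tensor products
(`sandwichedQPosDef_piTensor`), the one-shot bound with `τ^{⊗n}`, and Hölder's inequality for the
average over the messages give `P_s ≤ L^{n/α} ((Tr τ)^n / M)^p` (`successProb_le`).

*Choice of the reference operator.* If `χ*_α(W) < c`, there is for every `δ > 0` a density operator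
`σ` with `Q*_α(W(x)‖σ + δI) ≤ exp((α - 1) c)` for all `x` at once
(`exists_forall_sandwichedQPosDef_le`). For averages over a finitely supported `P` such a `σ` is
given by the definition of the capacity: the limit defining `Q*_α` of a classical-quantum state
exists (`tendsto_sandwichedQ`) and dominates the average of the `Q*_α(W(x)‖σ + δI)`
(`average_le_sandwichedQ`). Since `σ ↦ Q*_α(ρ‖σ + δI)` is continuous and, by operator convexity of
`x ↦ x^{-p}`, convex (`sandwichedQPosDef_convex`), Sion's minimax theorem and compactness of the set
of density operators exchange the average over `x` with the choice of `σ`. The regularization `δ`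
keeps all functions finite and continuous, and it is removed only after `n → ∞`; so neither
additivity of the capacity nor the exact value of `Q*_α` on singular operators is needed.
-/

namespace CQ

open Matrix Filter Topology
open scoped ComplexOrder MatrixOrder

/-! ### Quadratic forms and the spectral theorem -/

section QuadraticForm
variable {d : Type*} [Fintype d]

/-- The real part of the quadratic form `⟨v, A v⟩` of a matrix. -/
def quad (A : Matrix d d ℂ) (v : d → ℂ) : ℝ := (star v ⬝ᵥ A *ᵥ v).re

lemma quad_add (A B : Matrix d d ℂ) (v : d → ℂ) : quad (A + B) v = quad A v + quad B v := by
  simp [quad, add_mulVec]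

lemma quad_smul (t : ℝ) (A : Matrix d d ℂ) (v : d → ℂ) :
    quad ((t : ℂ) • A) v = t * quad A v := by
  simp [quad, smul_mulVec]

lemma quad_mono {A B : Matrix d d ℂ} (h : A ≤ B) (v : d → ℂ) : quad A v ≤ quad B v := by
  have h1 := (Matrix.le_iff.mp h).dotProduct_mulVec_nonneg v
  have h2 := (Complex.le_def.mp h1).1
  simp only [sub_mulVec, dotProduct_sub, Complex.sub_re, Complex.zero_re] at h2
  unfold quad
  linarith

lemma quad_nonneg {A : Matrix d d ℂ} (h : A.PosSemidef) (v : d → ℂ) : 0 ≤ quad A v :=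
  (Complex.le_def.mp (h.dotProduct_mulVec_nonneg v)).1

lemma quad_conj (A K : Matrix d d ℂ) (v : d → ℂ) : quad (Kᴴ * A * K) v = quad A (K *ᵥ v) := by
  unfold quad
  rw [← mulVec_mulVec, ← mulVec_mulVec, star_mulVec, ← dotProduct_mulVec]

end QuadraticForm

section Spectral
variable {d : Type*} [Fintype d] [DecidableEq d]

lemma continuousOn_spectrum (f : ℝ → ℝ) (A : Matrix d d ℂ) : ContinuousOn f (spectrum ℝ A) :=
  (Matrix.finite_real_spectrum (𝕜 := ℂ) (A := A)).continuousOn f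

/-- A Hermitian matrix is `U diag(a) Uᴴ` with `U` unitary and `a` real, and the functional calculus
acts on the diagonal entries. -/
lemma exists_diagonalization {A : Matrix d d ℂ} (hA : A.IsHermitian) :
    ∃ (U : Matrix d d ℂ) (a : d → ℝ), Uᴴ * U = 1 ∧ U * Uᴴ = 1 ∧ (∀ i, a i ∈ spectrum ℝ A) ∧
      A = U * diagonal (fun i => (a i : ℂ)) * Uᴴ ∧
      ∀ f : ℝ → ℝ, cfc f A = U * diagonal (fun i => (f (a i) : ℂ)) * Uᴴ := by
  refine ⟨hA.eigenvectorUnitary, hA.eigenvalues, ?_, ?_, hA.eigenvalues_mem_spectrum_real, ?_,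
    fun f => ?_⟩
  · exact Unitary.coe_star_mul_self hA.eigenvectorUnitary
  · exact Unitary.coe_mul_star_self hA.eigenvectorUnitary
  · conv_lhs => rw [hA.spectral_theorem]
    rfl
  · rw [hA.cfc_eq]
    rfl

/-- The functional calculus of `U diag(a) Uᴴ` for any unitary `U`. -/
lemma cfc_conj_diagonal {U : Matrix d d ℂ} (hU : Uᴴ * U = 1) (a : d → ℝ) (f : ℝ → ℝ) :
    cfc f (U * diagonal (fun i => (a i : ℂ)) * Uᴴ)
      = U * diagonal (fun i => (f (a i) : ℂ)) * Uᴴ := by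
  have hU' : U * Uᴴ = 1 := mul_eq_one_comm.mp hU
  let φ : (d → ℝ) →ₐ[ℝ] Matrix d d ℂ :=
    { toFun := fun a => U * diagonal (fun i => (a i : ℂ)) * Uᴴ
      map_one' := by simp [hU']
      map_mul' := fun a b => by
        have : U * diagonal (fun i => (a i : ℂ)) * Uᴴ * (U * diagonal (fun i => (b i : ℂ)) * Uᴴ)
            = U * (diagonal (fun i => (a i : ℂ)) * (Uᴴ * U) * diagonal (fun i => (b i : ℂ)))
              * Uᴴ := by
          simp only [Matrix.mul_assoc]
        rw [this, hU, Matrix.mul_one, diagonal_mul_diagonal]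
        simp
      map_zero' := by simp
      map_add' := fun a b => by
        rw [← Matrix.add_mul, ← Matrix.mul_add, diagonal_add]
        simp
      commutes' := fun r => by
        have h : (diagonal (fun i => ((algebraMap ℝ (d → ℝ) r i : ℝ) : ℂ)) : Matrix d d ℂ)
            = (r : ℂ) • 1 := by
          ext i j
          by_cases hij : i = j <;> simp [hij]
        rw [h]
        simp only [Matrix.mul_smul, Matrix.smul_mul, Matrix.mul_one, hU']
        rw [Algebra.algebraMap_eq_smul_one]
        ext i j
        simp }
  have hsa : IsSelfAdjoint (φ a) := by
    rw [← isHermitian_iff_isSelfAdjoint]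
    change (U * diagonal (fun i => (a i : ℂ)) * Uᴴ)ᴴ = U * diagonal (fun i => (a i : ℂ)) * Uᴴ
    simp only [conjTranspose_mul, conjTranspose_conjTranspose, diagonal_conjTranspose,
      Matrix.mul_assoc]
    congr 3
    funext i
    exact Complex.conj_ofReal _
  -- `f` agrees with a polynomial on the finite set of points that matter.
  obtain ⟨q, hq⟩ : ∃ q : Polynomial ℝ, ∀ x ∈ spectrum ℝ (φ a) ∪ Set.range a, q.eval x = f x := by
    have hfin : (spectrum ℝ (φ a) ∪ Set.range a).Finite :=
      (Matrix.finite_real_spectrum (𝕜 := ℂ)).union (Set.finite_range a)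
    refine ⟨Lagrange.interpolate hfin.toFinset id f, fun x hx => ?_⟩
    exact Lagrange.eval_interpolate_at_node (v := id) f (Set.injOn_id _) (by simpa using hx)
  have h1 : cfc f (φ a) = cfc q.eval (φ a) :=
    cfc_congr fun x hx => (hq x (Or.inl hx)).symm
  change cfc f (φ a) = φ (fun i => f (a i))
  rw [h1, cfc_polynomial q (φ a), Polynomial.aeval_algHom_apply]
  congr 1
  funext i
  rw [← hq (a i) (Or.inr ⟨i, rfl⟩)]
  exact (Polynomial.aeval_algHom_apply (Pi.evalAlgHom ℝ (fun _ : d => ℝ) i) a q).symm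

lemma quad_diagonal (a : d → ℝ) (v : d → ℂ) :
    quad (diagonal (fun i => (a i : ℂ))) v = ∑ i, a i * Complex.normSq (v i) := by
  unfold quad
  simp only [dotProduct, mulVec_diagonal, Complex.re_sum, Pi.star_apply]
  refine Finset.sum_congr rfl fun i _ => ?_
  simp [Complex.normSq_apply]
  ring

lemma quad_one (v : d → ℂ) : quad 1 v = ∑ i, Complex.normSq (v i) := by
  have := quad_diagonal (fun _ => 1) v
  simpa using this

/-- Jensen's inequality for the spectral measure of a subnormalized vector. -/
lemma map_quad_le {A : Matrix d d ℂ} (hA : A.PosSemidef) {f : ℝ → ℝ}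
    (hf : ConvexOn ℝ (Set.Ici 0) f) (hf0 : f 0 = 0) {v : d → ℂ} (hv : quad 1 v ≤ 1) :
    f (quad A v) ≤ quad (cfc f A) v := by
  obtain ⟨U, a, h1, h2, ha, hA', hfc⟩ := exists_diagonalization hA.1
  have ha0 : ∀ i, 0 ≤ a i := fun i =>
    spectrum_nonneg_of_nonneg (Matrix.nonneg_iff_posSemidef.mpr hA) (ha i)
  rw [hfc f]
  conv_lhs => rw [hA']
  have hconj : ∀ b : d → ℝ, quad (U * diagonal (fun i => (b i : ℂ)) * Uᴴ) v
      = ∑ i, Complex.normSq ((Uᴴ *ᵥ v) i) * b i := fun b => by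
    have := quad_conj (diagonal (fun i => (b i : ℂ))) Uᴴ v
    rw [conjTranspose_conjTranspose] at this
    rw [this, quad_diagonal]
    exact Finset.sum_congr rfl fun i _ => mul_comm _ _
  rw [hconj a, hconj (fun i => f (a i))]
  have hw : ∑ i, Complex.normSq ((Uᴴ *ᵥ v) i) ≤ 1 := by
    rw [← quad_one, ← quad_conj]
    simpa [h2] using hv
  have := hf.map_add_sum_le (t := Finset.univ) (w := fun i => Complex.normSq ((Uᴴ *ᵥ v) i))
    (p := a) (v := 1 - ∑ i, Complex.normSq ((Uᴴ *ᵥ v) i)) (q := 0)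
    (fun i _ => Complex.normSq_nonneg _) (by ring) (fun i _ => ha0 i) (by linarith)
    (by simp)
  simpa [hf0] using this

end Spectral

/-! ### Trace inequalities -/

section TraceInequalities
variable {d : Type*} [Fintype d] [DecidableEq d]

/-- A Hermitian matrix has an orthonormal eigenbasis `u`: traces are sums of quadratic forms over
`u`, and the traces of functions of the matrix are sums over the eigenvalues `quad A (u i)`. -/
lemma exists_eigenbasis {A : Matrix d d ℂ} (hA : A.IsHermitian) :
    ∃ u : d → d → ℂ, (∀ i, quad 1 (u i) = 1) ∧
      (∀ B : Matrix d d ℂ, B.trace.re = ∑ i, quad B (u i)) ∧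
      (∀ f : ℝ → ℝ, (cfc f A).trace.re = ∑ i, f (quad A (u i))) ∧
      (∀ B : Matrix d d ℂ, (A * B).trace.re = ∑ i, quad A (u i) * quad B (u i)) := by
  obtain ⟨U, a, h1, h2, ha, hA', hfc⟩ := exists_diagonalization hA
  have hq : ∀ (B : Matrix d d ℂ) i, quad B (fun j => U j i) = ((Uᴴ * B * U) i i).re := by
    intro B i
    simp only [quad, dotProduct, mulVec, Matrix.mul_apply, Complex.re_sum, conjTranspose_apply,
      Pi.star_apply, Finset.mul_sum, Finset.sum_mul]
    rw [Finset.sum_comm]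
    simp only [mul_assoc]
  have hdiag : Uᴴ * A * U = diagonal (fun i => (a i : ℂ)) := by
    have : Uᴴ * (U * diagonal (fun i => (a i : ℂ)) * Uᴴ) * U
        = (Uᴴ * U) * diagonal (fun i => (a i : ℂ)) * (Uᴴ * U) := by
      simp only [Matrix.mul_assoc]
    conv_lhs => rw [hA', this, h1, Matrix.one_mul, Matrix.mul_one]
  have htr : ∀ B : Matrix d d ℂ, (Uᴴ * B * U).trace = B.trace := fun B => by
    rw [trace_mul_comm, ← Matrix.mul_assoc, h2, Matrix.one_mul]
  have hqa : ∀ i, quad A (fun j => U j i) = a i := fun i => by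
    rw [hq, hdiag]; simp
  refine ⟨fun i j => U j i, fun i => ?_, fun B => ?_, fun f => ?_, fun B => ?_⟩
  · rw [hq]; simp [h1]
  · rw [← htr B, trace, Complex.re_sum]
    exact Finset.sum_congr rfl fun i _ => (hq B i).symm
  · rw [hfc, trace_mul_comm, ← Matrix.mul_assoc, h1, Matrix.one_mul, trace_diagonal,
      Complex.re_sum]
    exact Finset.sum_congr rfl fun i _ => by rw [hqa]; simp
  · rw [← htr (A * B)]
    have : Uᴴ * (A * B) * U = diagonal (fun i => (a i : ℂ)) * (Uᴴ * B * U) := by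
      rw [← hdiag]
      have : Uᴴ * A * U * (Uᴴ * B * U) = Uᴴ * (A * (U * Uᴴ) * B) * U := by
        simp only [Matrix.mul_assoc]
      rw [this, h2, Matrix.mul_one]
    rw [this, trace, Complex.re_sum]
    refine Finset.sum_congr rfl fun i _ => ?_
    rw [hqa, hq, diag_apply, diagonal_mul, Complex.re_ofReal_mul]

/-- The trace functional `A ↦ Tr f(A)` is monotone and convex. -/
lemma trace_cfc_le_of_le_convexComb {f : ℝ → ℝ} (hf : ConvexOn ℝ (Set.Ici 0) f)
    (hm : MonotoneOn f (Set.Ici 0)) (hf0 : f 0 = 0) {X Y Z : Matrix d d ℂ} (hX : X.PosSemidef)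
    (hY : Y.PosSemidef) (hZ : Z.PosSemidef) {s t : ℝ} (hs : 0 ≤ s) (ht : 0 ≤ t) (hst : s + t = 1)
    (h : X ≤ (s : ℂ) • Y + (t : ℂ) • Z) :
    (cfc f X).trace.re ≤ s * (cfc f Y).trace.re + t * (cfc f Z).trace.re := by
  obtain ⟨u, hu1, hutr, huf, -⟩ := exists_eigenbasis hX.1
  rw [huf, hutr (cfc f Y), hutr (cfc f Z), Finset.mul_sum, Finset.mul_sum,
    ← Finset.sum_add_distrib]
  refine Finset.sum_le_sum fun i _ => ?_
  have hq := quad_mono h (u i)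
  rw [quad_add, quad_smul, quad_smul] at hq
  have hY0 := quad_nonneg hY (u i)
  have hZ0 := quad_nonneg hZ (u i)
  calc f (quad X (u i)) ≤ f (s * quad Y (u i) + t * quad Z (u i)) :=
        hm (quad_nonneg hX _) (by simp only [Set.mem_Ici]; positivity) hq
    _ ≤ s * f (quad Y (u i)) + t * f (quad Z (u i)) := hf.2 hY0 hZ0 hs ht hst
    _ ≤ _ := by
        gcongr
        · exact map_quad_le hY hf hf0 (hu1 i).le
        · exact map_quad_le hZ hf hf0 (hu1 i).le

lemma trace_cfc_mono {f : ℝ → ℝ} (hf : ConvexOn ℝ (Set.Ici 0) f)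
    (hm : MonotoneOn f (Set.Ici 0)) (hf0 : f 0 = 0) {X Y : Matrix d d ℂ} (hX : X.PosSemidef)
    (hY : Y.PosSemidef) (h : X ≤ Y) : (cfc f X).trace.re ≤ (cfc f Y).trace.re := by
  simpa using trace_cfc_le_of_le_convexComb hf hm hf0 hX hY hY zero_le_one le_rfl (by norm_num)
    (by simpa using h)

/-- The trace Jensen inequality for compressions by a contraction. -/
lemma trace_cfc_conj_le {f : ℝ → ℝ} (hf : ConvexOn ℝ (Set.Ici 0) f) (hf0 : f 0 = 0)
    {A K : Matrix d d ℂ} (hA : A.PosSemidef) (hK : Kᴴ * K ≤ 1) :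
    (cfc f (Kᴴ * A * K)).trace.re ≤ (Kᴴ * cfc f A * K).trace.re := by
  obtain ⟨u, hu1, hutr, huf, -⟩ := exists_eigenbasis (hA.conjTranspose_mul_mul_same K).1
  rw [huf, hutr (Kᴴ * cfc f A * K)]
  refine Finset.sum_le_sum fun i _ => ?_
  rw [quad_conj, quad_conj]
  refine map_quad_le hA hf hf0 ?_
  rw [← quad_conj, Matrix.mul_one]
  exact (quad_mono hK _).trans (hu1 i).le

/-- Functions of `A B` and of `B A` have the same trace, as the two products have the same
characteristic polynomial. -/
lemma trace_cfc_mul_comm (f : ℝ → ℝ) {A B : Matrix d d ℂ} (hAB : (A * B).IsHermitian)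
    (hBA : (B * A).IsHermitian) : (cfc f (A * B)).trace.re = (cfc f (B * A)).trace.re := by
  have key : ∀ {C : Matrix d d ℂ}, C.IsHermitian →
      (cfc f C).trace.re = (C.charpoly.roots.map fun z => f z.re).sum := fun {C} hC => by
    rw [hC.roots_charpoly_eq_eigenvalues, hC.cfc_eq, IsHermitian.cfc,
      Unitary.conjStarAlgAut_apply, trace_mul_comm, ← Matrix.mul_assoc]
    simp [trace_diagonal]
  rw [key hAB, key hBA, charpoly_mul_comm]

/-- Hölder's inequality for the trace of a product of positive semidefinite matrices. -/
lemma trace_mul_le_holder {α β : ℝ} (h : α.HolderConjugate β) {X Y : Matrix d d ℂ}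
    (hX : X.PosSemidef) (hY : Y.PosSemidef) :
    (X * Y).trace.re ≤ (cfc (fun x : ℝ => x ^ α) X).trace.re ^ (1 / α)
      * (cfc (fun x : ℝ => x ^ β) Y).trace.re ^ (1 / β) := by
  obtain ⟨u, hu1, hutr, huf, hmul⟩ := exists_eigenbasis hX.1
  rw [hmul, huf, hutr (cfc _ Y)]
  have h0 : ∀ i, 0 ≤ quad Y (u i) := fun i => quad_nonneg hY _
  refine (Real.inner_le_Lp_mul_Lq_of_nonneg Finset.univ h
    (fun i _ => quad_nonneg hX (u i)) (fun i _ => h0 i)).trans ?_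
  have hβ := h.symm.lt
  have hx : (0:ℝ) ≤ ∑ i, quad X (u i) ^ α :=
    Finset.sum_nonneg fun i _ => Real.rpow_nonneg (quad_nonneg hX _) _
  gcongr with i
  · exact Finset.sum_nonneg fun i _ => Real.rpow_nonneg (h0 i) _
  · exact map_quad_le hY (convexOn_rpow hβ.le) (Real.zero_rpow (by linarith)) (hu1 i).le

end TraceInequalities

/-! ### Powers of positive semidefinite matrices -/

section Sandwich
variable {d : Type*} [Fintype d]

lemma isHermitian_mul_mul {A B : Matrix d d ℂ} (hA : A.IsHermitian) (hB : B.IsHermitian) :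
    (A * B * A).IsHermitian := by
  have := isHermitian_conjTranspose_mul_mul A hB
  rwa [hA.eq] at this

lemma posSemidef_mul_mul {A B : Matrix d d ℂ} (hA : A.IsHermitian) (hB : B.PosSemidef) :
    (A * B * A).PosSemidef := by
  have := hB.conjTranspose_mul_mul_same A
  rwa [hA.eq] at this

lemma mul_mul_mono {A B C : Matrix d d ℂ} (hA : A.IsHermitian) (h : B ≤ C) :
    A * B * A ≤ A * C * A := by
  rw [Matrix.le_iff] at h ⊢
  have := posSemidef_mul_mul hA h
  rwa [Matrix.mul_sub, Matrix.sub_mul] at this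

lemma posSemidef_trace_re_nonneg {A : Matrix d d ℂ} (hA : A.PosSemidef) : 0 ≤ A.trace.re :=
  (Complex.le_def.mp hA.trace_nonneg).1

lemma posSemidef_trace_eq_re {A : Matrix d d ℂ} (hA : A.PosSemidef) :
    A.trace = (A.trace.re : ℂ) := by
  refine Complex.ext rfl ?_
  simpa using (Complex.le_def.mp hA.trace_nonneg).2.symm

end Sandwich

section SuppPow
variable {d : Type*} [Fintype d] [DecidableEq d]

lemma suppPow_eq_cfc {p : ℝ} (hp : p ≠ 0) (A : Matrix d d ℂ) :
    suppPow A p = cfc (fun x : ℝ => x ^ p) A := by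
  unfold suppPow
  congr 1
  funext x
  split_ifs with h
  · rw [h, Real.zero_rpow hp]
  · rfl

lemma suppPow_isHermitian (A : Matrix d d ℂ) (p : ℝ) : (suppPow A p).IsHermitian :=
  isHermitian_iff_isSelfAdjoint.mpr (cfc_predicate _ A)

lemma spectrum_nonneg_of_posSemidef {A : Matrix d d ℂ} (hA : A.PosSemidef) {x : ℝ}
    (hx : x ∈ spectrum ℝ A) : 0 ≤ x :=
  spectrum_nonneg_of_nonneg (Matrix.nonneg_iff_posSemidef.mpr hA) hx

lemma spectrum_pos_of_posDef {A : Matrix d d ℂ} (hA : A.PosDef) {x : ℝ}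
    (hx : x ∈ spectrum ℝ A) : 0 < x :=
  hA.isStrictlyPositive.spectrum_pos hx

lemma suppPow_posSemidef {A : Matrix d d ℂ} (hA : A.PosSemidef) (p : ℝ) :
    (suppPow A p).PosSemidef := by
  rw [← Matrix.nonneg_iff_posSemidef]
  refine cfc_nonneg fun x hx => ?_
  have := spectrum_nonneg_of_posSemidef hA hx
  split_ifs
  · exact le_rfl
  · positivity

lemma suppPow_mul_suppPow {A : Matrix d d ℂ} (hA : A.PosSemidef) (p q : ℝ) :
    suppPow A p * suppPow A q = suppPow A (p + q) := by
  unfold suppPow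
  rw [← cfc_mul _ _ A (continuousOn_spectrum _ A) (continuousOn_spectrum _ A)]
  refine cfc_congr fun x hx => ?_
  have := spectrum_nonneg_of_posSemidef hA hx
  by_cases h : x = 0
  · simp [h]
  · simp only [h, if_false]
    rw [Real.rpow_add (lt_of_le_of_ne this (Ne.symm h))]

lemma suppPow_one {A : Matrix d d ℂ} (hA : A.PosSemidef) : suppPow A 1 = A := by
  rw [suppPow_eq_cfc one_ne_zero]
  simp only [Real.rpow_one]
  exact cfc_id' ℝ A hA.1.isSelfAdjoint

lemma suppPow_zero {A : Matrix d d ℂ} (hA : A.PosDef) : suppPow A 0 = 1 := by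
  unfold suppPow
  rw [← cfc_one ℝ A hA.1.isSelfAdjoint]
  refine cfc_congr fun x hx => ?_
  simp [(spectrum_pos_of_posDef hA hx).ne']

lemma suppPow_suppPow {A : Matrix d d ℂ} (hA : A.PosSemidef) (p q : ℝ) :
    suppPow (suppPow A p) q = suppPow A (p * q) := by
  unfold suppPow
  rw [← cfc_comp' _ _ A
    (((Matrix.finite_real_spectrum (𝕜 := ℂ) (A := A)).image _).continuousOn _)
    (continuousOn_spectrum _ A) hA.1.isSelfAdjoint]
  refine cfc_congr fun x hx => ?_
  have h0 := spectrum_nonneg_of_posSemidef hA hx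
  by_cases h : x = 0
  · simp [h]
  · have hx : 0 < x := lt_of_le_of_ne h0 (Ne.symm h)
    simp only [h, if_false, (Real.rpow_pos_of_pos hx p).ne', Real.rpow_mul h0]

lemma suppPow_eq_rpow {A : Matrix d d ℂ} (hA : A.PosDef) (p : ℝ) :
    suppPow A p = A ^ p := by
  rw [CFC.rpow_eq_cfc_real hA.isStrictlyPositive.nonneg]
  refine cfc_congr fun x hx => ?_
  simp [(spectrum_pos_of_posDef hA hx).ne']

lemma suppPow_half_mul_self {A : Matrix d d ℂ} (hA : A.PosSemidef) :
    suppPow A (1 / 2) * suppPow A (1 / 2) = A := by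
  rw [suppPow_mul_suppPow hA, add_halves, suppPow_one hA]

lemma sandwichedQPosDef_nonneg (α : ℝ) {ρ σ : Matrix d d ℂ} (hσ : σ.PosSemidef) :
    0 ≤ sandwichedQPosDef α ρ σ :=
  posSemidef_trace_re_nonneg (suppPow_posSemidef
    (posSemidef_mul_mul (suppPow_isHermitian _ _) (suppPow_posSemidef hσ _)) _)

/-- The sandwiched quantity with the roles of the two factors of the sandwich exchanged. -/
lemma sandwichedQPosDef_eq_swap (α : ℝ) {ρ σ : Matrix d d ℂ} (hρ : ρ.PosSemidef)
    (hσ : σ.PosSemidef) :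
    sandwichedQPosDef α ρ σ =
      (suppPow (suppPow σ ((1 - α) / α / 2) * ρ * suppPow σ ((1 - α) / α / 2)) α).trace.re := by
  have h1 : suppPow σ ((1 - α) / α)
      = suppPow σ ((1 - α) / α / 2) * suppPow σ ((1 - α) / α / 2) := by
    rw [suppPow_mul_suppPow hσ, add_halves]
  have hR := suppPow_isHermitian ρ (1 / 2)
  have hS := suppPow_isHermitian σ ((1 - α) / α / 2)
  have hρ' := suppPow_half_mul_self hρ
  unfold sandwichedQPosDef
  rw [h1]
  set R := suppPow ρ (1 / 2)
  set S := suppPow σ ((1 - α) / α / 2)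
  have e1 : R * (S * S) * R = (R * S) * (S * R) := by simp only [Matrix.mul_assoc]
  have e2 : S * ρ * S = (S * R) * (R * S) := by rw [← hρ']; simp only [Matrix.mul_assoc]
  rw [e1, e2]
  unfold suppPow
  refine trace_cfc_mul_comm _ ?_ ?_
  · rw [← e1]
    exact isHermitian_mul_mul hR (by simpa [hS.eq] using isHermitian_conjTranspose_mul_self S)
  · rw [← e2]
    exact isHermitian_mul_mul hS hρ.1

/-- The one-shot bound on the success of a test `D` on the state `ρ`: it is Hölder's inequality for
`Tr ρD = Tr (τ^{-p/2} ρ τ^{-p/2}) (τ^{p/2} D τ^{p/2})`, `p = (α-1)/α`, in which the second factor is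
estimated by the trace Jensen inequality for the contraction `D^{1/2}`. -/
lemma trace_mul_effect_le {α : ℝ} (hα : 1 < α) {ρ D τ : Matrix d d ℂ} (hρ : ρ.PosSemidef)
    (hD : D.PosSemidef) (hD1 : D ≤ 1) (hτ : τ.PosDef) :
    (ρ * D).trace.re ≤ sandwichedQPosDef α ρ τ ^ (1 / α) * (τ * D).trace.re ^ ((α - 1) / α) := by
  have hα0 : 0 < α := by linarith
  have hp : 0 < (α - 1) / α := div_pos (by linarith) hα0
  have hconj : α.HolderConjugate (α / (α - 1)) :=
    Real.HolderConjugate.conjExponent hα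
  have hτ' := hτ.posSemidef
  set S := suppPow τ ((1 - α) / α / 2) with hSdef
  set T := suppPow τ ((α - 1) / α / 2) with hTdef
  set E := suppPow D (1 / 2) with hEdef
  have hS : S.IsHermitian := suppPow_isHermitian _ _
  have hT : T.IsHermitian := suppPow_isHermitian _ _
  have hE : E.IsHermitian := suppPow_isHermitian _ _
  have hEE : E * E = D := suppPow_half_mul_self hD
  have hTS : T * S = 1 := by
    rw [hTdef, hSdef, suppPow_mul_suppPow hτ', ← suppPow_zero hτ]
    congr 1
    ring
  have hST : S * T = 1 := mul_eq_one_comm.mp hTS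
  have hTT : T * T = suppPow τ ((α - 1) / α) := by
    rw [hTdef, suppPow_mul_suppPow hτ', add_halves]
  have htr : (ρ * D).trace = ((S * ρ * S) * (T * D * T)).trace := by
    have : (S * ρ * S) * (T * D * T) = S * (ρ * (S * T) * D * T) := by
      simp only [Matrix.mul_assoc]
    rw [this, trace_mul_comm S, hST, Matrix.mul_one, Matrix.mul_assoc, hTS, Matrix.mul_one]
  have hH := trace_mul_le_holder hconj (posSemidef_mul_mul hS hρ) (posSemidef_mul_mul hT hD)
  have hβ : 1 < α / (α - 1) := hconj.symm.lt
  have hY : (cfc (fun x : ℝ => x ^ (α / (α - 1))) (T * D * T)).trace.re ≤ (τ * D).trace.re := by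
    have e1 : T * D * T = (T * E) * (E * T) := by rw [← hEE]; simp only [Matrix.mul_assoc]
    have e2 : (E * T) * (T * E) = Eᴴ * suppPow τ ((α - 1) / α) * E := by
      rw [← hTT, hE.eq]; simp only [Matrix.mul_assoc]
    rw [e1, trace_cfc_mul_comm]
    · rw [e2]
      refine (trace_cfc_conj_le (convexOn_rpow hβ.le) (Real.zero_rpow (by linarith))
        (suppPow_posSemidef hτ' _) (by rw [hE.eq, hEE]; exact hD1)).trans ?_
      rw [← suppPow_eq_cfc (by linarith), suppPow_suppPow hτ']
      have : (α - 1) / α * (α / (α - 1)) = 1 := by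
        have : α - 1 ≠ 0 := by linarith
        field_simp
      rw [this, suppPow_one hτ', hE.eq, trace_mul_comm, ← Matrix.mul_assoc, hEE, trace_mul_comm]
    · rw [← e1]; exact isHermitian_mul_mul hT hD.1
    · rw [e2, hE.eq]; exact isHermitian_mul_mul hE (suppPow_isHermitian _ _)
  rw [htr, sandwichedQPosDef_eq_swap α hρ hτ', suppPow_eq_cfc (by linarith)]
  refine hH.trans ?_
  have hexp : 1 / (α / (α - 1)) = (α - 1) / α := by rw [one_div_div]
  rw [hexp]
  have h1 : 0 ≤ (cfc (fun x : ℝ => x ^ (α / (α - 1))) (T * D * T)).trace.re := by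
    rw [← suppPow_eq_cfc (by linarith)]
    exact posSemidef_trace_re_nonneg (suppPow_posSemidef (posSemidef_mul_mul hT hD) _)
  have h2 : 0 ≤ (cfc (fun x : ℝ => x ^ α) (S * ρ * S)).trace.re := by
    rw [← suppPow_eq_cfc (by linarith)]
    exact posSemidef_trace_re_nonneg (suppPow_posSemidef (posSemidef_mul_mul hS hρ) _)
  gcongr

end SuppPow

/-! ### Operator monotonicity and convexity of negative powers -/

lemma posDef_of_le {d : Type*} {A B : Matrix d d ℂ} (hA : A.PosDef) (h : A ≤ B) : B.PosDef := by
  have := hA.add_posSemidef (Matrix.le_iff.mp h)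
  simpa using this

section NegativePowers
variable {d : Type*} [Fintype d] [DecidableEq d]

lemma suppPow_posDef {A : Matrix d d ℂ} (hA : A.PosDef) (p : ℝ) : (suppPow A p).PosDef := by
  rw [(suppPow_posSemidef hA.posSemidef p).posDef_iff_isUnit]
  refine IsUnit.of_mul_eq_one (suppPow A (-p)) ?_
  rw [suppPow_mul_suppPow hA.posSemidef, add_neg_cancel, suppPow_zero hA]

lemma ringInverse_eq_suppPow {A : Matrix d d ℂ} (hA : A.PosDef) :
    Ring.inverse A = suppPow A (-1) := by
  rw [suppPow_eq_rpow hA]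
  exact CFC.inverse_eq_rpow_neg_one hA.isStrictlyPositive

lemma suppPow_neg_eq_ringInverse {A : Matrix d d ℂ} (hA : A.PosDef) (p : ℝ) :
    suppPow A (-p) = Ring.inverse (suppPow A p) := by
  rw [ringInverse_eq_suppPow (suppPow_posDef hA p), suppPow_suppPow hA.posSemidef, mul_neg_one]

open scoped Matrix.Norms.L2Operator in
lemma suppPow_neg_antitone {p : ℝ} (hp : p ∈ Set.Icc (0 : ℝ) 1) {A B : Matrix d d ℂ}
    (hA : A.PosDef) (h : A ≤ B) : suppPow B (-p) ≤ suppPow A (-p) := by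
  have hB := posDef_of_le hA h
  have h1 : suppPow A p ≤ suppPow B p := by
    rw [suppPow_eq_rpow hA, suppPow_eq_rpow hB]
    exact CFC.rpow_le_rpow hp h
  rw [suppPow_neg_eq_ringInverse hA, suppPow_neg_eq_ringInverse hB]
  have hA' := (suppPow_posDef hA p).isStrictlyPositive
  exact CStarAlgebra.ringInverse_le_ringInverse h1

open scoped Matrix.Norms.L2Operator in
/-- Operator convexity of `x ↦ x ^ (-p)` for `0 ≤ p ≤ 1`. -/
lemma suppPow_neg_convex {p : ℝ} (hp : p ∈ Set.Icc (0 : ℝ) 1) {A B : Matrix d d ℂ}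
    (hA : A.PosDef) (hB : B.PosDef) {s t : ℝ} (hs : 0 ≤ s) (ht : 0 ≤ t) (hst : s + t = 1) :
    suppPow (s • A + t • B) (-p) ≤ s • suppPow A (-p) + t • suppPow B (-p) := by
  have hconv := (CStarAlgebra.convexOn_ringInverse (A := Matrix d d ℂ))
  have hC : (s • A + t • B).PosDef := by
    have := hconv.1 hA.isStrictlyPositive hB.isStrictlyPositive hs ht hst
    exact Matrix.isStrictlyPositive_iff_posDef.mp this
  have hC' : (s • suppPow A p + t • suppPow B p).PosDef := by
    have := hconv.1 (suppPow_posDef hA p).isStrictlyPositive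
      (suppPow_posDef hB p).isStrictlyPositive hs ht hst
    exact Matrix.isStrictlyPositive_iff_posDef.mp this
  have h1 : s • suppPow A p + t • suppPow B p ≤ suppPow (s • A + t • B) p := by
    rw [suppPow_eq_rpow hA, suppPow_eq_rpow hB, suppPow_eq_rpow hC]
    exact (CFC.concaveOn_rpow hp).2 hA.isStrictlyPositive.nonneg hB.isStrictlyPositive.nonneg
      hs ht hst
  rw [suppPow_neg_eq_ringInverse hC, suppPow_neg_eq_ringInverse hA, suppPow_neg_eq_ringInverse hB]
  have hC'' := hC'.isStrictlyPositive
  refine (CStarAlgebra.ringInverse_le_ringInverse h1).trans ?_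
  exact hconv.2 (suppPow_posDef hA p).isStrictlyPositive
      (suppPow_posDef hB p).isStrictlyPositive hs ht hst

end NegativePowers

/-! ### The sandwiched quantity as a function of its arguments -/

section SandwichedQ
variable {d : Type*} [Fintype d] [DecidableEq d] {α : ℝ}

lemma monotoneOn_rpow_Ici (hα : 0 ≤ α) : MonotoneOn (fun x : ℝ => x ^ α) (Set.Ici 0) :=
  fun _ hx _ _ hxy => Real.rpow_le_rpow hx hxy hα

lemma one_sub_div_eq_neg_and_mem_Icc (hα : 1 < α) :
    (1 - α) / α = -((α - 1) / α) ∧ (α - 1) / α ∈ Set.Icc (0 : ℝ) 1 := by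
  have h0 : 0 < α := by linarith
  refine ⟨by ring, div_nonneg (by linarith) h0.le, ?_⟩
  rw [div_le_one h0]; linarith

/-- `τ ↦ Q*_α(ρ‖τ)` is antitone. -/
lemma sandwichedQPosDef_antitone (hα : 1 < α) (ρ : Matrix d d ℂ) {A B : Matrix d d ℂ}
    (hA : A.PosDef) (h : A ≤ B) : sandwichedQPosDef α ρ B ≤ sandwichedQPosDef α ρ A := by
  obtain ⟨he, hp⟩ := one_sub_div_eq_neg_and_mem_Icc hα
  have hR := suppPow_isHermitian ρ (1 / 2)
  have hB := posDef_of_le hA h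
  unfold sandwichedQPosDef
  rw [he, suppPow_eq_cfc (by linarith), suppPow_eq_cfc (p := α) (by linarith)]
  exact trace_cfc_mono (convexOn_rpow hα.le) (monotoneOn_rpow_Ici (by linarith))
    (Real.zero_rpow (by linarith))
    (posSemidef_mul_mul hR (suppPow_posSemidef hB.posSemidef _))
    (posSemidef_mul_mul hR (suppPow_posSemidef hA.posSemidef _))
    (mul_mul_mono hR (suppPow_neg_antitone hp hA h))

/-- `ρ ↦ Q*_α(ρ‖τ)` is monotone. -/
lemma sandwichedQPosDef_mono_left (hα : 1 < α) {ρ ρ' τ : Matrix d d ℂ} (hρ : ρ.PosSemidef)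
    (h : ρ ≤ ρ') (hτ : τ.PosSemidef) : sandwichedQPosDef α ρ τ ≤ sandwichedQPosDef α ρ' τ := by
  have hρ' : ρ'.PosSemidef := by
    rw [← Matrix.nonneg_iff_posSemidef] at hρ ⊢
    exact hρ.trans h
  have hS := suppPow_isHermitian τ ((1 - α) / α / 2)
  rw [sandwichedQPosDef_eq_swap α hρ hτ, sandwichedQPosDef_eq_swap α hρ' hτ,
    suppPow_eq_cfc (p := α) (by linarith), suppPow_eq_cfc (p := α) (by linarith)]
  exact trace_cfc_mono (convexOn_rpow hα.le) (monotoneOn_rpow_Ici (by linarith))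
    (Real.zero_rpow (by linarith)) (posSemidef_mul_mul hS hρ) (posSemidef_mul_mul hS hρ')
    (mul_mul_mono hS h)

/-- `τ ↦ Q*_α(ρ‖τ)` is convex. -/
lemma sandwichedQPosDef_convex (hα : 1 < α) (ρ : Matrix d d ℂ) {A B : Matrix d d ℂ}
    (hA : A.PosDef) (hB : B.PosDef) {s t : ℝ} (hs : 0 ≤ s) (ht : 0 ≤ t) (hst : s + t = 1) :
    sandwichedQPosDef α ρ (s • A + t • B)
      ≤ s * sandwichedQPosDef α ρ A + t * sandwichedQPosDef α ρ B := by
  obtain ⟨he, hp⟩ := one_sub_div_eq_neg_and_mem_Icc hα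
  have hR := suppPow_isHermitian ρ (1 / 2)
  have hC : (s • A + t • B).PosSemidef :=
    (hA.posSemidef.smul hs).add (hB.posSemidef.smul ht)
  unfold sandwichedQPosDef
  rw [he]
  simp only [suppPow_eq_cfc (p := α) (by linarith)]
  refine trace_cfc_le_of_le_convexComb (convexOn_rpow hα.le) (monotoneOn_rpow_Ici (by linarith))
    (Real.zero_rpow (by linarith))
    (posSemidef_mul_mul hR (suppPow_posSemidef hC _))
    (posSemidef_mul_mul hR (suppPow_posSemidef hA.posSemidef _))
    (posSemidef_mul_mul hR (suppPow_posSemidef hB.posSemidef _)) hs ht hst ?_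
  have := mul_mul_mono hR (suppPow_neg_convex hp hA hB hs ht hst)
  refine this.trans_eq ?_
  simp only [Matrix.mul_add, Matrix.add_mul, Matrix.mul_smul, Matrix.smul_mul, Complex.coe_smul]

open scoped Matrix.Norms.L2Operator in
/-- `τ ↦ Q*_α(ρ‖τ)` is continuous on the positive definite matrices. -/
lemma continuousOn_sandwichedQPosDef (hα : 1 < α) (ρ : Matrix d d ℂ) :
    ContinuousOn (fun τ => sandwichedQPosDef α ρ τ) {τ : Matrix d d ℂ | τ.PosDef} := by
  obtain ⟨he, hp⟩ := one_sub_div_eq_neg_and_mem_Icc hα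
  have hR := suppPow_isHermitian ρ (1 / 2)
  have h1 : ContinuousOn (fun τ : Matrix d d ℂ => suppPow τ ((1 - α) / α))
      {τ : Matrix d d ℂ | τ.PosDef} := by
    have hopen : Set.Ioi (0 : ℝ) ∈
        nhdsSet (⋃ τ ∈ {τ : Matrix d d ℂ | τ.PosDef}, spectrum ℝ τ) := by
      refine isOpen_Ioi.mem_nhdsSet.mpr ?_
      simp only [Set.iUnion_subset_iff]
      exact fun τ hτ x hx => spectrum_pos_of_posDef hτ hx
    refine (ContinuousOn.cfc_of_mem_nhdsSet (fun x : ℝ => x ^ ((1 - α) / α)) hopen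
      continuousOn_id (fun τ hτ => hτ.1.isSelfAdjoint)
      fun x hx => (Real.continuousAt_rpow_const x _ (Or.inl (ne_of_gt hx))).continuousWithinAt).congr
        fun τ hτ => ?_
    refine suppPow_eq_cfc ?_ τ
    rw [he]
    exact neg_ne_zero.mpr (div_pos (by linarith) (by linarith)).ne'
  have h2 : ContinuousOn (fun τ : Matrix d d ℂ =>
      suppPow (suppPow ρ (1 / 2) * suppPow τ ((1 - α) / α) * suppPow ρ (1 / 2)) α)
      {τ : Matrix d d ℂ | τ.PosDef} := by
    refine (ContinuousOn.cfc_of_mem_nhdsSet (s := Set.univ) (fun x : ℝ => x ^ α)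
      (Filter.univ_mem) ((continuousOn_const.mul h1).mul continuousOn_const)
      (fun τ hτ => (isHermitian_mul_mul hR (suppPow_isHermitian τ _)).isSelfAdjoint)
      (Real.continuous_rpow_const (by linarith)).continuousOn).congr fun τ hτ => ?_
    exact suppPow_eq_cfc (by linarith) _
  have h3 : Continuous (fun A : Matrix d d ℂ => A.trace.re) :=
    Complex.continuous_re.comp (continuous_id.matrix_trace)
  exact h3.comp_continuousOn h2

end SandwichedQ

/-! ### Existence of the limit defining the sandwiched quantity -/

section Regularization
variable {d : Type*} [DecidableEq d]

lemma posDef_add_smul_one {σ : Matrix d d ℂ} (hσ : σ.PosSemidef) {ε : ℝ} (hε : 0 < ε) :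
    (σ + ε • (1 : Matrix d d ℂ)).PosDef :=
  Matrix.PosDef.posSemidef_add hσ (PosDef.one.smul hε)

lemma add_smul_one_mono (σ : Matrix d d ℂ) {ε δ : ℝ} (h : ε ≤ δ) :
    σ + ε • (1 : Matrix d d ℂ) ≤ σ + δ • (1 : Matrix d d ℂ) := by
  rw [Matrix.le_iff]
  have : σ + δ • (1 : Matrix d d ℂ) - (σ + ε • (1 : Matrix d d ℂ)) = (δ - ε) • 1 := by
    rw [sub_smul]; abel
  rw [this]
  exact PosSemidef.one.smul (sub_nonneg.mpr h)

lemma le_add_smul_one (σ : Matrix d d ℂ) {ε : ℝ} (h : 0 ≤ ε) :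
    σ ≤ σ + ε • (1 : Matrix d d ℂ) := by
  simpa using add_smul_one_mono σ h

end Regularization

section Limit
variable {d : Type*} [Fintype d] [DecidableEq d] {α : ℝ}

lemma suppPow_smul {A : Matrix d d ℂ} (hA : A.PosSemidef) {c : ℝ} (hc : 0 < c) (p : ℝ) :
    suppPow (c • A) p = c ^ p • suppPow A p := by
  unfold suppPow
  have hfin : (spectrum ℝ A).Finite := Matrix.finite_real_spectrum (𝕜 := ℂ)
  rw [← cfc_comp_smul c _ A ((hfin.image _).continuousOn _) hA.1.isSelfAdjoint,
    ← cfc_smul _ _ A (continuousOn_spectrum _ A)]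
  refine cfc_congr fun x hx => ?_
  have h0 := spectrum_nonneg_of_posSemidef hA hx
  by_cases h : x = 0
  · simp [h]
  · simp [h, hc.ne', Real.mul_rpow hc.le h0]

lemma sandwichedQPosDef_smul_left {ρ τ : Matrix d d ℂ} (hρ : ρ.PosSemidef)
    (hτ : τ.PosSemidef) {c : ℝ} (hc : 0 < c) :
    sandwichedQPosDef α (c • ρ) τ = c ^ α * sandwichedQPosDef α ρ τ := by
  rw [sandwichedQPosDef_eq_swap α (hρ.smul hc.le) hτ, sandwichedQPosDef_eq_swap α hρ hτ,
    Matrix.mul_smul, Matrix.smul_mul,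
    suppPow_smul (posSemidef_mul_mul (suppPow_isHermitian _ _) hρ) hc, trace_smul]
  simp

lemma sandwichedQPosDef_smul_right {ρ τ : Matrix d d ℂ} (hα : 1 < α)
    (hτ : τ.PosSemidef) {c : ℝ} (hc : 0 < c) :
    sandwichedQPosDef α ρ (c • τ) = c ^ (1 - α) * sandwichedQPosDef α ρ τ := by
  unfold sandwichedQPosDef
  rw [suppPow_smul hτ hc, Matrix.mul_smul, Matrix.smul_mul,
    suppPow_smul (posSemidef_mul_mul (suppPow_isHermitian _ _) (suppPow_posSemidef hτ _))
      (Real.rpow_pos_of_pos hc _), trace_smul, ← Real.rpow_mul hc.le,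
    div_mul_cancel₀ _ (by linarith : α ≠ 0)]
  simp

lemma sandwichedQPosDef_one_one : sandwichedQPosDef α (1 : Matrix d d ℂ) 1 = Fintype.card d := by
  have h1 : ∀ p : ℝ, suppPow (1 : Matrix d d ℂ) p = 1 := fun p => by
    unfold suppPow
    rw [cfc_apply_one]
    simp
  simp [sandwichedQPosDef, h1]

/-- `ρ ↦ Q*_α(ρ‖τ)` is convex. -/
lemma sandwichedQPosDef_convex_left (hα : 1 < α) {ρ₁ ρ₂ τ : Matrix d d ℂ} (h₁ : ρ₁.PosSemidef)
    (h₂ : ρ₂.PosSemidef) (hτ : τ.PosSemidef) {s t : ℝ} (hs : 0 ≤ s) (ht : 0 ≤ t)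
    (hst : s + t = 1) :
    sandwichedQPosDef α (s • ρ₁ + t • ρ₂) τ
      ≤ s * sandwichedQPosDef α ρ₁ τ + t * sandwichedQPosDef α ρ₂ τ := by
  have hS := suppPow_isHermitian τ ((1 - α) / α / 2)
  have h₃ := (h₁.smul hs).add (h₂.smul ht)
  rw [sandwichedQPosDef_eq_swap α h₁ hτ, sandwichedQPosDef_eq_swap α h₂ hτ,
    sandwichedQPosDef_eq_swap α h₃ hτ]
  simp only [suppPow_eq_cfc (p := α) (by linarith)]
  refine trace_cfc_le_of_le_convexComb (convexOn_rpow hα.le) (monotoneOn_rpow_Ici (by linarith))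
    (Real.zero_rpow (by linarith)) (posSemidef_mul_mul hS h₃) (posSemidef_mul_mul hS h₁)
    (posSemidef_mul_mul hS h₂) hs ht hst (le_of_eq ?_)
  simp only [Matrix.mul_add, Matrix.add_mul, Matrix.mul_smul, Matrix.smul_mul, Complex.coe_smul]

/-- Regularizing the first argument as well changes `Q*_α` only by a vanishing amount: this is
convexity in the first argument with weights `1 - t` and `t`. -/
lemma sandwichedQPosDef_regularized_le (hα : 1 < α) {ρ σ : Matrix d d ℂ} (hρ : ρ.PosSemidef)
    (hσ : σ.PosSemidef) {ε t : ℝ} (hε : 0 < ε) (ht : 0 < t) (ht1 : t < 1) :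
    sandwichedQPosDef α (ρ + ε • 1) (σ + ε • 1)
      ≤ (1 - t) ^ (1 - α) * sandwichedQPosDef α ρ (σ + ε • 1)
        + t ^ (1 - α) * ε * Fintype.card d := by
  have hτ := posDef_add_smul_one hσ hε
  have ht' : 0 < 1 - t := by linarith
  have hdec : ρ + ε • (1 : Matrix d d ℂ) = (1 - t) • ((1 - t)⁻¹ • ρ) + t • ((ε / t) • 1) := by
    rw [smul_smul, smul_smul, mul_inv_cancel₀ ht'.ne', one_smul, mul_div_cancel₀ _ ht.ne']
  have h1 := sandwichedQPosDef_convex_left hα (hρ.smul (inv_nonneg.mpr ht'.le))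
    (PosSemidef.one.smul (div_pos hε ht).le) hτ.posSemidef ht'.le ht.le (by ring)
  rw [← hdec, sandwichedQPosDef_smul_left hρ hτ.posSemidef (inv_pos.mpr ht'),
    sandwichedQPosDef_smul_left PosSemidef.one hτ.posSemidef (div_pos hε ht)] at h1
  have h2 : sandwichedQPosDef α (1 : Matrix d d ℂ) (σ + ε • 1)
      ≤ ε ^ (1 - α) * Fintype.card d := by
    rw [← sandwichedQPosDef_one_one (α := α) (d := d),
      ← sandwichedQPosDef_smul_right hα PosSemidef.one hε]
    refine sandwichedQPosDef_antitone hα 1 (PosDef.one.smul hε) ?_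
    rw [Matrix.le_iff]
    simpa using hσ
  refine h1.trans (add_le_add (le_of_eq ?_) ?_)
  · rw [← mul_assoc, Real.inv_rpow ht'.le, ← Real.rpow_neg ht'.le]
    congr 1
    nth_rewrite 1 [← Real.rpow_one (1 - t)]
    rw [← Real.rpow_add ht']
    ring_nf
  · calc t * ((ε / t) ^ α * sandwichedQPosDef α (1 : Matrix d d ℂ) (σ + ε • 1))
        ≤ t * ((ε / t) ^ α * (ε ^ (1 - α) * Fintype.card d)) := by gcongr
      _ = (t ^ (1 : ℝ) * (t ^ α)⁻¹) * (ε ^ α * ε ^ (1 - α)) * Fintype.card d := by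
          rw [Real.div_rpow hε.le ht.le, Real.rpow_one]; ring
      _ = t ^ (1 - α) * ε * Fintype.card d := by
          rw [← Real.rpow_neg ht.le, ← Real.rpow_add ht, ← Real.rpow_add hε]
          simp [sub_eq_add_neg]

/-- The limit that defines `sandwichedQ` exists: `Q*_α(ρ‖σ + εI)` increases as `ε` decreases, and it
differs from `Q*_α(ρ + εI‖σ + εI)` by a vanishing amount. -/
lemma tendsto_sandwichedQ (hα : 1 < α) {ρ σ : Matrix d d ℂ} (hρ : ρ.PosSemidef)
    (hσ : σ.PosSemidef) :
    Tendsto (fun ε : ℝ => ENNReal.ofReal (sandwichedQPosDef α (ρ + (ε : ℂ) • 1) (σ + (ε : ℂ) • 1)))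
      (𝓝[>] 0) (𝓝 (sandwichedQ α ρ σ)) := by
  suffices h : ∃ L : ENNReal, Tendsto (fun ε : ℝ =>
      ENNReal.ofReal (sandwichedQPosDef α (ρ + (ε : ℂ) • 1) (σ + (ε : ℂ) • 1))) (𝓝[>] 0) (𝓝 L) from
    tendsto_nhds_limUnder h
  simp only [Complex.coe_smul]
  let g : ℝ → ENNReal := fun ε => ENNReal.ofReal (sandwichedQPosDef α ρ (σ + ε • 1))
  have hg : AntitoneOn g (Set.Ioi 0) := fun ε hε δ hδ hεδ =>
    ENNReal.ofReal_le_ofReal (sandwichedQPosDef_antitone hα ρ (posDef_add_smul_one hσ hε)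
      (add_smul_one_mono σ hεδ))
  have hlim := hg.tendsto_nhdsGT (OrderTop.bddAbove _)
  set L := sSup (g '' Set.Ioi 0)
  have hα0 : 0 < 1 / α := by positivity
  have hpow : Tendsto (fun ε : ℝ => ε ^ (1 / α)) (𝓝[>] 0) (𝓝 0) := by
    have := (Real.continuous_rpow_const hα0.le).tendsto (0 : ℝ)
    rw [Real.zero_rpow hα0.ne'] at this
    exact this.mono_left nhdsWithin_le_nhds
  have hup : Tendsto (fun ε : ℝ => ENNReal.ofReal ((1 - ε ^ (1 / α)) ^ (1 - α)) * g ε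
      + ENNReal.ofReal (ε ^ (1 / α) * Fintype.card d)) (𝓝[>] 0) (𝓝 L) := by
    have h1 : Tendsto (fun ε : ℝ => ENNReal.ofReal ((1 - ε ^ (1 / α)) ^ (1 - α))) (𝓝[>] 0)
        (𝓝 1) := by
      have h : Tendsto (fun ε : ℝ => (1 - ε ^ (1 / α)) ^ (1 - α)) (𝓝[>] 0)
          (𝓝 ((1 - 0) ^ (1 - α))) :=
        (tendsto_const_nhds.sub hpow).rpow_const (Or.inl (by norm_num))
      simpa using ENNReal.tendsto_ofReal h
    have h2 : Tendsto (fun ε : ℝ => ENNReal.ofReal (ε ^ (1 / α) * Fintype.card d)) (𝓝[>] 0)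
        (𝓝 0) := by
      simpa using ENNReal.tendsto_ofReal (hpow.mul_const (Fintype.card d : ℝ))
    simpa using
      (ENNReal.Tendsto.mul h1 (Or.inl one_ne_zero) hlim (Or.inr ENNReal.one_ne_top)).add h2
  have hsmall : ∀ᶠ ε : ℝ in 𝓝[>] 0, ε ∈ Set.Ioo (0 : ℝ) 1 := Ioo_mem_nhdsGT one_pos
  refine ⟨L, tendsto_of_tendsto_of_tendsto_of_le_of_le' hlim hup ?_ ?_⟩
  · filter_upwards [hsmall] with ε hε
    exact ENNReal.ofReal_le_ofReal (sandwichedQPosDef_mono_left hα hρ (le_add_smul_one ρ hε.1.le)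
      (posDef_add_smul_one hσ hε.1).posSemidef)
  · filter_upwards [hsmall] with ε hε
    have ht : 0 < ε ^ (1 / α) := Real.rpow_pos_of_pos hε.1 _
    have ht1 : ε ^ (1 / α) < 1 := Real.rpow_lt_one hε.1.le hε.2 hα0
    have h := sandwichedQPosDef_regularized_le hα hρ hσ hε.1 ht ht1
    -- The choice `t = ε^{1/α}` turns the error `t^{1-α} ε` into `ε^{1/α}`.
    have he : (ε ^ (1 / α)) ^ (1 - α) * ε = ε ^ (1 / α) := by
      rw [← Real.rpow_mul hε.1.le]
      nth_rewrite 2 [← Real.rpow_one ε]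
      rw [← Real.rpow_add hε.1]
      congr 1
      field_simp
      ring
    rw [he] at h
    refine (ENNReal.ofReal_le_ofReal h).trans ?_
    refine ENNReal.ofReal_add_le.trans ?_
    rw [ENNReal.ofReal_mul (Real.rpow_nonneg (by linarith) _)]

/-- `Q*_α(ρ‖τ)` is a lower bound for `Q*_α(ρ‖σ)` as soon as `τ` dominates `σ` with room to spare. -/
lemma sandwichedQPosDef_le_sandwichedQ (hα : 1 < α) {ρ σ τ : Matrix d d ℂ} (hρ : ρ.PosSemidef)
    (hσ : σ.PosSemidef) {δ : ℝ} (hδ : 0 < δ) (hτ : σ + δ • 1 ≤ τ) :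
    ENNReal.ofReal (sandwichedQPosDef α ρ τ) ≤ sandwichedQ α ρ σ := by
  refine ge_of_tendsto (tendsto_sandwichedQ hα hρ hσ) ?_
  filter_upwards [Ioo_mem_nhdsGT hδ] with ε hε
  simp only [Complex.coe_smul]
  have hε' := posDef_add_smul_one hσ hε.1
  refine ENNReal.ofReal_le_ofReal ?_
  exact (sandwichedQPosDef_antitone hα ρ hε' ((add_smul_one_mono σ hε.2.le).trans hτ)).trans
    (sandwichedQPosDef_mono_left hα hρ (le_add_smul_one ρ hε.1.le) hε'.posSemidef)

end Limit

/-! ### Block diagonal matrices -/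

section BlockDiagonal
variable {o d : Type*} [DecidableEq o]

/-- The block diagonal matrix `∑ₓ |x⟩⟨x| ⊗ M x`. The block index comes first, unlike in
`Matrix.blockDiagonal`. -/
def cqBlock (M : o → Matrix d d ℂ) : Matrix (o × d) (o × d) ℂ :=
  (blockDiagonal M).submatrix Prod.swap Prod.swap

lemma cqBlock_apply (M : o → Matrix d d ℂ) (i j : o × d) :
    cqBlock M i j = if i.1 = j.1 then M i.1 i.2 j.2 else 0 := rfl

lemma cqBlock_conjTranspose (M : o → Matrix d d ℂ) :
    (cqBlock M)ᴴ = cqBlock (fun x => (M x)ᴴ) := by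
  unfold cqBlock
  rw [conjTranspose_submatrix, blockDiagonal_conjTranspose]

lemma cqBlock_one [DecidableEq d] : cqBlock (1 : o → Matrix d d ℂ) = 1 := by
  unfold cqBlock
  rw [blockDiagonal_one]
  exact submatrix_one_equiv (Equiv.prodComm o d)

lemma cqBlock_diagonal [DecidableEq d] (a : o → d → ℂ) :
    cqBlock (fun x => diagonal (a x)) = diagonal (fun i => a i.1 i.2) := by
  ext i j
  rw [cqBlock_apply, diagonal_apply, diagonal_apply]
  by_cases h : i = j
  · simp [h]
  · rw [if_neg h]
    split_ifs with h1 h2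
    · exact absurd (Prod.ext h1 h2) h
    · rfl
    · rfl

variable [Fintype o] [Fintype d]

lemma cqBlock_mul (M N : o → Matrix d d ℂ) :
    cqBlock M * cqBlock N = cqBlock (fun x => M x * N x) := by
  unfold cqBlock
  rw [blockDiagonal_mul]
  exact submatrix_mul_equiv (blockDiagonal M) (blockDiagonal N) Prod.swap (Equiv.prodComm o d)
    Prod.swap

lemma trace_cqBlock (M : o → Matrix d d ℂ) : (cqBlock M).trace = ∑ x, (M x).trace := by
  simp [trace, cqBlock_apply, Fintype.sum_prod_type]

variable [DecidableEq d]

lemma suppPow_cqBlock {M : o → Matrix d d ℂ} (hM : ∀ x, (M x).IsHermitian) (p : ℝ) :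
    suppPow (cqBlock M) p = cqBlock (fun x => suppPow (M x) p) := by
  choose U a h1 h2 ha hMU hcfc using fun x => exists_diagonalization (hM x)
  have key : ∀ b : o → d → ℝ,
      cqBlock (fun x => U x * diagonal (fun i => (b x i : ℂ)) * (U x)ᴴ)
        = cqBlock U * diagonal (fun i => (b i.1 i.2 : ℂ)) * (cqBlock U)ᴴ := fun b => by
    rw [← cqBlock_diagonal (fun x i => (b x i : ℂ)), cqBlock_conjTranspose, cqBlock_mul,
      cqBlock_mul]
  have hU : (cqBlock U)ᴴ * cqBlock U = 1 := by
    rw [cqBlock_conjTranspose, cqBlock_mul, ← cqBlock_one]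
    exact congrArg cqBlock (funext h1)
  have hM' : M = fun x => U x * diagonal (fun i => (a x i : ℂ)) * (U x)ᴴ := funext hMU
  unfold suppPow
  simp only [hcfc]
  conv_lhs => rw [hM']
  rw [key, key (fun x i => if a x i = 0 then 0 else a x i ^ p)]
  exact cfc_conj_diagonal hU (fun i : o × d => a i.1 i.2) _

lemma sandwichedQPosDef_cqBlock (α : ℝ) {M N : o → Matrix d d ℂ} (hM : ∀ x, (M x).IsHermitian)
    (hN : ∀ x, (N x).IsHermitian) :
    sandwichedQPosDef α (cqBlock M) (cqBlock N) = ∑ x, sandwichedQPosDef α (M x) (N x) := by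
  unfold sandwichedQPosDef
  rw [suppPow_cqBlock hM, suppPow_cqBlock hN, cqBlock_mul, cqBlock_mul, suppPow_cqBlock
    fun x => isHermitian_mul_mul (suppPow_isHermitian _ _) (suppPow_isHermitian _ _),
    trace_cqBlock, Complex.re_sum]

lemma cqBlock_posSemidef {M : o → Matrix d d ℂ} (hM : ∀ x, (M x).PosSemidef) :
    (cqBlock M).PosSemidef := by
  have : cqBlock M = (cqBlock fun x => suppPow (M x) (1 / 2)) *
      (cqBlock fun x => suppPow (M x) (1 / 2))ᴴ := by
    rw [cqBlock_conjTranspose, cqBlock_mul]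
    congr 1
    funext x
    rw [(suppPow_isHermitian _ _).eq, suppPow_half_mul_self (hM x)]
  rw [this]
  exact posSemidef_self_mul_conjTranspose _

end BlockDiagonal

/-! ### Tensor products -/

section TensorPower
variable {ι d : Type*} [Fintype ι]

/-- The tensor product `⨂ᵢ M i`, as a matrix indexed by `ι → d`. -/
def piTensor (M : ι → Matrix d d ℂ) : Matrix (ι → d) (ι → d) ℂ :=
  Matrix.of fun a b => ∏ i, M i (a i) (b i)

lemma piTensor_apply (M : ι → Matrix d d ℂ) (a b : ι → d) :
    piTensor M a b = ∏ i, M i (a i) (b i) := rfl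

lemma piTensor_conjTranspose (M : ι → Matrix d d ℂ) :
    (piTensor M)ᴴ = piTensor (fun i => (M i)ᴴ) := by
  ext a b
  simp [piTensor_apply, conjTranspose_apply]

lemma piTensor_diagonal [DecidableEq d] (a : ι → d → ℂ) :
    piTensor (fun i => diagonal (a i)) = diagonal (fun v => ∏ i, a i (v i)) := by
  ext v w
  rw [piTensor_apply, diagonal_apply]
  split_ifs with h
  · subst h
    simp
  · obtain ⟨i, hi⟩ := Function.ne_iff.mp h
    exact Finset.prod_eq_zero (Finset.mem_univ i) (diagonal_apply_ne _ hi)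

lemma piTensor_one [DecidableEq d] : piTensor (1 : ι → Matrix d d ℂ) = 1 := by
  have := piTensor_diagonal (ι := ι) (d := d) (fun _ _ => 1)
  simp only [diagonal_one, Finset.prod_const_one] at this
  exact this

variable [DecidableEq ι] [Fintype d]

lemma piTensor_mul (M N : ι → Matrix d d ℂ) :
    piTensor M * piTensor N = piTensor (fun i => M i * N i) := by
  ext a b
  simp only [Matrix.mul_apply, piTensor_apply, ← Finset.prod_mul_distrib]
  rw [Finset.prod_univ_sum, Fintype.piFinset_univ]

lemma trace_piTensor (M : ι → Matrix d d ℂ) : (piTensor M).trace = ∏ i, (M i).trace := by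
  simp only [trace, diag_apply, piTensor_apply]
  rw [Finset.prod_univ_sum, Fintype.piFinset_univ]

variable [DecidableEq d]

lemma piTensor_posSemidef {M : ι → Matrix d d ℂ} (hM : ∀ i, (M i).PosSemidef) :
    (piTensor M).PosSemidef := by
  have : piTensor M = (piTensor fun i => suppPow (M i) (1 / 2)) *
      (piTensor fun i => suppPow (M i) (1 / 2))ᴴ := by
    rw [piTensor_conjTranspose, piTensor_mul]
    congr 1
    funext x
    rw [(suppPow_isHermitian _ _).eq, suppPow_half_mul_self (hM x)]
  rw [this]
  exact posSemidef_self_mul_conjTranspose _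

lemma piTensor_posDef {M : ι → Matrix d d ℂ} (hM : ∀ i, (M i).PosDef) :
    (piTensor M).PosDef := by
  rw [(piTensor_posSemidef fun i => (hM i).posSemidef).posDef_iff_isUnit]
  refine IsUnit.of_mul_eq_one (piTensor fun i => suppPow (M i) (-1)) ?_
  rw [piTensor_mul, ← piTensor_one]
  congr 1
  funext i
  have := suppPow_mul_suppPow (hM i).posSemidef 1 (-1)
  rwa [suppPow_one (hM i).posSemidef, add_neg_cancel, suppPow_zero (hM i)] at this

lemma suppPow_piTensor {M : ι → Matrix d d ℂ} (hM : ∀ i, (M i).PosSemidef) (p : ℝ) :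
    suppPow (piTensor M) p = piTensor (fun i => suppPow (M i) p) := by
  choose U a h1 h2 ha hMU hcfc using fun i => exists_diagonalization (hM i).1
  have key : ∀ b : ι → d → ℝ,
      piTensor (fun i => U i * diagonal (fun j => (b i j : ℂ)) * (U i)ᴴ)
        = piTensor U * diagonal (fun v => ((∏ i, b i (v i) : ℝ) : ℂ)) * (piTensor U)ᴴ := fun b => by
    simp only [Complex.ofReal_prod]
    rw [← piTensor_diagonal (fun i j => (b i j : ℂ)), piTensor_conjTranspose, piTensor_mul,
      piTensor_mul]
  have hU : (piTensor U)ᴴ * piTensor U = 1 := by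
    rw [piTensor_conjTranspose, piTensor_mul, ← piTensor_one]
    exact congrArg piTensor (funext h1)
  have hM' : M = fun i => U i * diagonal (fun j => (a i j : ℂ)) * (U i)ᴴ := funext hMU
  unfold suppPow
  simp only [hcfc]
  conv_lhs => rw [hM']
  rw [key, key (fun i j => if a i j = 0 then 0 else a i j ^ p),
    cfc_conj_diagonal hU (fun v => ∏ i, a i (v i))]
  congr 3
  funext v
  have h0 : ∀ i, 0 ≤ a i (v i) := fun i => spectrum_nonneg_of_posSemidef (hM i) (ha i _)
  by_cases h : ∃ i, a i (v i) = 0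
  · obtain ⟨i, hi⟩ := h
    rw [if_pos (Finset.prod_eq_zero (Finset.mem_univ i) hi),
      Finset.prod_eq_zero (Finset.mem_univ i) (by simp [hi])]
  · push Not at h
    rw [if_neg (Finset.prod_ne_zero_iff.mpr fun i _ => h i),
      ← Real.finsetProd_rpow _ _ fun i _ => h0 i]
    congr 1
    exact Finset.prod_congr rfl fun i _ => by rw [if_neg (h i)]

/-- `Q*_α` is multiplicative on tensor products. -/
lemma sandwichedQPosDef_piTensor (α : ℝ) {M N : ι → Matrix d d ℂ} (hM : ∀ i, (M i).PosSemidef)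
    (hN : ∀ i, (N i).PosSemidef) :
    sandwichedQPosDef α (piTensor M) (piTensor N) = ∏ i, sandwichedQPosDef α (M i) (N i) := by
  have h : ∀ i, (suppPow (M i) (1 / 2) * suppPow (N i) ((1 - α) / α)
      * suppPow (M i) (1 / 2)).PosSemidef := fun i =>
    posSemidef_mul_mul (suppPow_isHermitian _ _) (suppPow_posSemidef (hN i) _)
  unfold sandwichedQPosDef
  rw [suppPow_piTensor hM, suppPow_piTensor hN, piTensor_mul, piTensor_mul, suppPow_piTensor h,
    trace_piTensor, Finset.prod_congr rfl fun i _ =>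
      posSemidef_trace_eq_re (suppPow_posSemidef (h i) α), ← Complex.ofReal_prod,
    Complex.ofReal_re]

end TensorPower

/-! ### A minimax principle -/

section Minimax

/-- A minimax principle: if every finitely supported average of the convex continuous functions
`f x` is at most `c` somewhere on the compact convex set `S`, then so are all the `f x`
simultaneously. Compactness reduces this to finitely many `x`, where it is Sion's theorem on the
simplex. -/
lemma exists_forall_le_of_finProb {X E : Type*} [TopologicalSpace E] [AddCommGroup E] [Module ℝ E]
    [IsTopologicalAddGroup E] [ContinuousSMul ℝ E] [T2Space E] {S : Set E} (hS : IsCompact S)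
    (hSc : Convex ℝ S) (hSn : S.Nonempty) {f : X → E → ℝ} (hf : ∀ x, ConvexOn ℝ S (f x))
    (hfc : ∀ x, ContinuousOn (f x) S) {c : ℝ}
    (h : ∀ P : FinProb X, ∃ s ∈ S, (P.1.sum fun x p => p * f x s) ≤ c) :
    ∃ s ∈ S, ∀ x, f x s ≤ c := by
  classical
  have hfin : ∀ u : Finset X, (S ∩ ⋂ x ∈ u, (S ∩ f x ⁻¹' Set.Iic c)).Nonempty := by
    intro u
    by_contra hcon
    have hcon' : ∀ s ∈ S, ∃ x ∈ u, c < f x s := by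
      intro s hs
      by_contra! hx
      exact hcon ⟨s, hs, by simpa using fun x hxu => ⟨hs, hx x hxu⟩⟩
    obtain ⟨w, hw, hwc⟩ := Sion.exists_lt_iInf_of_lt_iInf_of_finite
      (X := S) (Y := stdSimplex ℝ u) (f := fun s w => ∑ x : u, w x * f x s) (t := c)
      (s := Set.range fun x : u => (Pi.single x 1 : u → ℝ)) hSn hS
      (fun w hw => (continuousOn_finsetSum Finset.univ fun (x : u) _ =>
        (continuousOn_const (c := w x)).mul (hfc x)).lowerSemicontinuousOn)
      (fun w hw => by
        refine ConvexOn.quasiconvexOn ⟨hSc, fun a ha b hb s t hs ht hst => ?_⟩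
        simp only [smul_eq_mul, Finset.mul_sum]
        rw [← Finset.sum_add_distrib]
        refine Finset.sum_le_sum fun x _ => ?_
        have := mul_le_mul_of_nonneg_left ((hf x).2 ha hb hs ht hst) (hw.1 x)
        simp only [smul_eq_mul] at this
        linarith)
      (convex_stdSimplex ℝ u)
      (fun s hs => (continuous_finsetSum _ fun x _ =>
        (continuous_apply x).mul continuous_const).continuousOn.upperSemicontinuousOn)
      (fun s hs => by
        have hlin : IsLinearMap ℝ fun w : u → ℝ => ∑ x : u, w x * f x s :=
          ⟨fun a b => by simp [add_mul, Finset.sum_add_distrib],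
            fun a b => by simp [Finset.mul_sum, mul_assoc]⟩
        exact (hlin.mk'.concaveOn (convex_stdSimplex ℝ u)).quasiconcaveOn)
      hSc (Set.finite_range _)
      (by rintro _ ⟨x, rfl⟩; exact single_mem_stdSimplex ℝ x)
      (fun s hs => by
        obtain ⟨x, hxu, hx⟩ := hcon' s hs
        refine ⟨_, ⟨⟨x, hxu⟩, rfl⟩, ?_⟩
        simpa [Pi.single_apply] using hx)
    let P : X →₀ ℝ := Finsupp.onFinset u (fun x => if hx : x ∈ u then w ⟨x, hx⟩ else 0)
      fun x hx => by
        by_contra hxu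
        simp [hxu] at hx
    have hPsum : ∀ g : X → ℝ, (P.sum fun x p => p * g x) = ∑ x : u, w x * g x := fun g => by
      rw [Finsupp.onFinset_sum _ (by simp), ← Finset.sum_coe_sort]
      exact Finset.sum_congr rfl fun x _ => by simp
    obtain ⟨s, hs, hle⟩ := h ⟨P, fun x => by
        change 0 ≤ (if hx : x ∈ u then w ⟨x, hx⟩ else 0)
        split_ifs
        · exact hw.1 _
        · exact le_rfl, by
        have := hPsum 1
        simp only [Pi.one_apply, mul_one] at this
        exact this.trans hw.2⟩
    exact absurd (hwc s hs) (not_lt.mpr ((hPsum fun x => f x s).symm.trans_le hle))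
  obtain ⟨s, hs, hs'⟩ := hS.inter_iInter_nonempty (fun x => S ∩ f x ⁻¹' Set.Iic c)
    (fun x => (hfc x).preimage_isClosed_of_isClosed hS.isClosed isClosed_Iic) hfin
  exact ⟨s, hs, fun x => (Set.mem_iInter.mp hs' x).2⟩

end Minimax

/-! ### The set of density matrices -/

section Density
variable {d : Type*} [Fintype d]

lemma convex_density : Convex ℝ {A : Matrix d d ℂ | A.PosSemidef ∧ A.trace = 1} := by
  rintro A ⟨hA, hA1⟩ B ⟨hB, hB1⟩ s t hs ht hst
  refine ⟨(hA.smul hs).add (hB.smul ht), ?_⟩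
  rw [trace_add, trace_smul, trace_smul, hA1, hB1, ← add_smul, hst, one_smul]

variable [DecidableEq d]

lemma density_le_one {A : Matrix d d ℂ} (hA : A.PosSemidef) (h1 : A.trace = 1) : A ≤ 1 := by
  obtain ⟨U, a, hU1, hU2, ha, hAU, -⟩ := exists_diagonalization hA.1
  have ha0 : ∀ i, 0 ≤ a i := fun i => spectrum_nonneg_of_posSemidef hA (ha i)
  have hsum : ∑ i, a i = 1 := by
    rw [hAU, trace_mul_comm, ← Matrix.mul_assoc, hU1, Matrix.one_mul, trace_diagonal] at h1
    exact_mod_cast h1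
  have ha1 : ∀ i, a i ≤ 1 := fun i =>
    hsum ▸ Finset.single_le_sum (fun j _ => ha0 j) (Finset.mem_univ i)
  rw [Matrix.le_iff]
  have : 1 - A = U * diagonal (fun i => ((1 - a i : ℝ) : ℂ)) * Uᴴ := by
    have hd : diagonal (fun i => ((1 - a i : ℝ) : ℂ)) = 1 - diagonal (fun i => (a i : ℂ)) := by
      rw [← diagonal_one, diagonal_sub]
      simp
    rw [hd, Matrix.mul_sub, Matrix.sub_mul, Matrix.mul_one, hU2, ← hAU]
  rw [this]
  refine (PosSemidef.diagonal fun i => ?_).mul_mul_conjTranspose_same U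
  exact Complex.zero_le_real.mpr (sub_nonneg.mpr (ha1 i))

open scoped Matrix.Norms.L2Operator in
lemma isCompact_density : IsCompact {A : Matrix d d ℂ | A.PosSemidef ∧ A.trace = 1} := by
  have : ProperSpace (Matrix d d ℂ) := FiniteDimensional.proper ℂ _
  refine Metric.isCompact_of_isClosed_isBounded ?_ ?_
  · have h1 : IsClosed {A : Matrix d d ℂ | 0 ≤ A} := CStarAlgebra.isClosed_nonneg
    simp only [Matrix.nonneg_iff_posSemidef] at h1
    exact h1.inter (isClosed_eq continuous_id.matrix_trace continuous_const)
  · refine (Metric.isBounded_closedBall (x := (0 : Matrix d d ℂ)) (r := 1)).subset ?_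
    rintro A ⟨hA, htr⟩
    rw [mem_closedBall_zero_iff]
    exact (CStarAlgebra.norm_le_one_iff_of_nonneg A
      (Matrix.nonneg_iff_posSemidef.mpr hA)).mpr (density_le_one hA htr)

end Density

/-! ### The Rényi capacity -/

lemma finProb_pos {X : Type*} (P : FinProb X) (x : P.1.support) : 0 < P.1 x :=
  lt_of_le_of_ne (P.2.1 x) (Ne.symm (Finsupp.mem_support_iff.mp x.2))

section Capacity
variable {X d : Type*} [Fintype d] {α : ℝ}

open Classical in
lemma cqState_eq (W : Channel X d) (P : FinProb X) :
    cqState W P = cqBlock (fun x : P.1.support => (P.1 x) • (W x).1) := by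
  ext i j
  rw [cqBlock_apply, cqState, Matrix.sum_apply]
  simp only [Matrix.smul_apply, kroneckerMap_apply, Matrix.single_apply]
  rw [Finset.sum_eq_single i.1 (fun x _ hx => by simp [hx]) (by simp)]
  by_cases h : i.1 = j.1 <;> simp [h]

open Classical in
lemma cqProd_eq (P : FinProb X) (σ : DensityOp d) :
    cqProd P σ = cqBlock (fun x : P.1.support => (P.1 x) • σ.1) := by
  ext i j
  rw [cqBlock_apply, cqProd, kroneckerMap_apply, Matrix.sum_apply]
  simp only [Matrix.smul_apply, Matrix.single_apply]
  rw [Finset.sum_eq_single i.1 (fun x _ hx => by simp [hx]) (by simp)]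
  by_cases h : i.1 = j.1 <;> simp [h]

lemma trace_cqState (W : Channel X d) (P : FinProb X) : (cqState W P).trace = 1 := by
  classical
  rw [cqState_eq, trace_cqBlock]
  simp only [trace_smul, (W _).2.2]
  have := P.2.2
  rw [Finsupp.sum, ← Finset.sum_coe_sort] at this
  simpa using congrArg (fun x : ℝ => (x : ℂ)) this

variable [DecidableEq d]

open Classical in
/-- The average of the `Q*_α(W(x)‖σ + δI)` bounds `Q*_α` of the classical-quantum state from below:
`P ⊗ σ + εI` is dominated by `P ⊗ (σ + δI)` for small `ε`, and on block diagonal operators `Q*_α` is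
the sum over the blocks, each of which scales with `P(x)^α P(x)^{1-α} = P(x)`. -/
lemma average_le_sandwichedQ (hα : 1 < α) (W : Channel X d) (P : FinProb X) (σ : DensityOp d)
    {δ : ℝ} (hδ : 0 < δ) :
    ENNReal.ofReal (P.1.sum fun x p => p * sandwichedQPosDef α (W x).1 (σ.1 + δ • 1))
      ≤ sandwichedQ α (cqState W P) (cqProd P σ) := by
  have hpos := finProb_pos P
  have hσ := posDef_add_smul_one σ.2.1 hδ
  obtain ⟨m, hm, hmP⟩ : ∃ m : ℝ, 0 < m ∧ ∀ x : P.1.support, m ≤ P.1 x := by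
    rcases isEmpty_or_nonempty P.1.support with h | h
    · exact ⟨1, one_pos, fun x => h.elim x⟩
    · obtain ⟨x, hx⟩ := Finite.exists_min fun x : P.1.support => P.1 x
      exact ⟨P.1 x, hpos x, hx⟩
  have hsum : (P.1.sum fun x p => p * sandwichedQPosDef α (W x).1 (σ.1 + δ • 1))
      = sandwichedQPosDef α (cqState W P)
        (cqBlock fun x : P.1.support => P.1 x • (σ.1 + δ • (1 : Matrix d d ℂ))) := by
    rw [cqState_eq, sandwichedQPosDef_cqBlock α
      (fun x : P.1.support => ((W x).2.1.smul (hpos x).le).1)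
      (fun x : P.1.support => (hσ.smul (hpos x)).1), Finsupp.sum, ← Finset.sum_coe_sort]
    refine Finset.sum_congr rfl fun x _ => ?_
    rw [sandwichedQPosDef_smul_right hα hσ.posSemidef (hpos x),
      sandwichedQPosDef_smul_left (W x).2.1 hσ.posSemidef (hpos x), ← mul_assoc,
      ← Real.rpow_add (hpos x)]
    simp
  rw [hsum]
  have hδm : 0 < m * δ := mul_pos hm hδ
  refine sandwichedQPosDef_le_sandwichedQ hα ?_ ?_ hδm ?_
  · rw [cqState_eq]
    exact cqBlock_posSemidef fun x => (W x).2.1.smul (hpos x).le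
  · rw [cqProd_eq]
    exact cqBlock_posSemidef fun x => σ.2.1.smul (hpos x).le
  · rw [cqProd_eq, Matrix.le_iff]
    have : (cqBlock fun x : P.1.support => P.1 x • (σ.1 + δ • (1 : Matrix d d ℂ)))
        - (cqBlock (fun x : P.1.support => P.1 x • σ.1) + (m * δ) • 1)
        = cqBlock fun x : P.1.support => ((P.1 x - m) * δ) • (1 : Matrix d d ℂ) := by
      rw [← cqBlock_one]
      ext i j
      simp only [Matrix.sub_apply, Matrix.add_apply, Matrix.smul_apply, cqBlock_apply]
      split_ifs
      · simp; ring
      · simp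
    rw [this]
    exact cqBlock_posSemidef fun x =>
      PosSemidef.one.smul (mul_nonneg (sub_nonneg.mpr (hmP x)) hδ.le)

/-- If the Rényi capacity is below `c`, then a single regularized density operator is within `c` of
all the output states of the channel in the sandwiched divergence. -/
lemma exists_forall_sandwichedQPosDef_le [Nonempty X] (hα : 1 < α) (W : Channel X d) {c : ℝ}
    (hc : renyiCapacity α W < c) {δ : ℝ} (hδ : 0 < δ) :
    ∃ σ : DensityOp d, ∀ x,
      sandwichedQPosDef α (W x).1 (σ.1 + δ • 1) ≤ Real.exp ((α - 1) * c) := by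
  have hα' : 0 < α - 1 := by linarith
  have hPD : ∀ {A : Matrix d d ℂ}, A ∈ {A : Matrix d d ℂ | A.PosSemidef ∧ A.trace = 1} →
      (A + δ • (1 : Matrix d d ℂ)).PosDef := fun hA => posDef_add_smul_one hA.1 hδ
  obtain ⟨σ, hσ, h⟩ := exists_forall_le_of_finProb (X := X) isCompact_density
    (convex_density (d := d)) ⟨(W (Classical.arbitrary X)).1, (W _).2⟩
    (f := fun x A => sandwichedQPosDef α (W x).1 (A + δ • 1)) (c := Real.exp ((α - 1) * c))
    (fun x => ⟨convex_density, fun A hA B hB s t hs ht hst => by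
      have := sandwichedQPosDef_convex hα (W x).1 (hPD hA) (hPD hB) hs ht hst
      have he : s • A + t • B + δ • (1 : Matrix d d ℂ)
          = s • (A + δ • (1 : Matrix d d ℂ)) + t • (B + δ • (1 : Matrix d d ℂ)) := by
        conv_lhs => rw [← one_smul ℝ (δ • (1 : Matrix d d ℂ)), ← hst]
        module
      simpa [he] using this⟩)
    (fun x => (continuousOn_sandwichedQPosDef hα (W x).1).comp
      (continuous_id.add continuous_const).continuousOn fun A hA => hPD hA)
    (fun P => by
      obtain ⟨σ, hσ⟩ := iInf_lt_iff.mp ((le_iSup (fun P => holevoQuantity α W P) P).trans_lt hc)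
      refine ⟨σ.1, σ.2, ?_⟩
      have hQ := average_le_sandwichedQ hα W P σ hδ
      set q := P.1.sum fun x p => p * sandwichedQPosDef α (W x).1 (σ.1 + δ • 1)
      rcases le_or_gt q 0 with hq | hq
      · exact hq.trans (Real.exp_pos _).le
      have hlog := ENNReal.log_le_log_iff.mpr hQ
      rw [ENNReal.log_ofReal_of_pos hq] at hlog
      unfold sandwichedD at hσ
      rw [trace_cqState] at hσ
      simp only [Complex.one_re, ENNReal.ofReal_one, ENNReal.log_one, mul_zero, sub_zero] at hσ
      have h1 : ((1 / (α - 1) * Real.log q : ℝ) : EReal) < (c : EReal) := by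
        rw [EReal.coe_mul]
        refine lt_of_le_of_lt ?_ hσ
        exact mul_le_mul_of_nonneg_left hlog (by exact_mod_cast (div_pos one_pos hα').le)
      have h2 : 1 / (α - 1) * Real.log q < c := by exact_mod_cast h1
      rw [← Real.log_le_iff_le_exp hq]
      rw [one_div, inv_mul_lt_iff₀ hα'] at h2
      exact h2.le)
  exact ⟨⟨σ, hσ⟩, h⟩

end Capacity

/-! ### Codes -/

section Coding
variable {X d : Type*} [Fintype d] [DecidableEq d] {α : ℝ}

lemma successProb_eq (W : Channel X d) {n : ℕ} (C : Code X d n) :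
    successProb W C
      = (1 / (C.card : ℝ)) * ∑ k, (piTensor (fun i => (W (C.enc k i)).1) * C.dec k).trace.re := by
  unfold successProb errorProb
  rw [sub_sub_cancel]
  rfl

lemma dec_le_one {n : ℕ} (C : Code X d n) (k : Fin C.card) : C.dec k ≤ 1 := by
  rw [← C.dec_sum]
  exact Finset.single_le_sum
    (fun j _ => Matrix.nonneg_iff_posSemidef.mpr (C.dec_posSemidef j)) (Finset.mem_univ k)

/-- The success probability of a code, bounded in terms of a reference operator `τ` that is
`Q*_α`-close to all the output states. The one-shot bound for the tests `D k` and the operator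
`τ^{⊗n}` is averaged over the messages with Hölder's inequality, as
`∑ₖ Tr τ^{⊗n} D k = (Tr τ)^n`. -/
lemma successProb_le (hα : 1 < α) (W : Channel X d) {τ : Matrix d d ℂ} (hτ : τ.PosDef) {L : ℝ}
    (hL : ∀ x, sandwichedQPosDef α (W x).1 τ ≤ L) {n : ℕ} (C : Code X d n) :
    successProb W C ≤ (L ^ n) ^ (1 / α) * (τ.trace.re ^ n / C.card) ^ ((α - 1) / α) := by
  have hα0 : 0 < α := by linarith
  have hα1 : 0 < α - 1 := by linarith
  have hp : 0 < (α - 1) / α := div_pos hα1 hα0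
  have hM : (0 : ℝ) < C.card := by exact_mod_cast C.card_pos
  have hconj : α.HolderConjugate (α / (α - 1)) := Real.HolderConjugate.conjExponent hα
  set T : Matrix (Fin n → d) (Fin n → d) ℂ := piTensor fun _ => τ with hTdef
  have hT : T.PosDef := piTensor_posDef fun _ => hτ
  have ht0 : ∀ k, 0 ≤ (T * C.dec k).trace.re := fun k => by
    have hR := suppPow_half_mul_self (C.dec_posSemidef k)
    rw [← hR, ← Matrix.mul_assoc, trace_mul_comm, ← Matrix.mul_assoc]
    exact posSemidef_trace_re_nonneg
      (posSemidef_mul_mul (suppPow_isHermitian _ _) hT.posSemidef)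
  have hsum : ∑ k, (T * C.dec k).trace.re = τ.trace.re ^ n := by
    rw [← Complex.re_sum, ← trace_sum, ← Finset.mul_sum, C.dec_sum, Matrix.mul_one, hTdef,
      trace_piTensor, posSemidef_trace_eq_re hτ.posSemidef]
    simp [← Complex.ofReal_pow]
  have hk : ∀ k, (piTensor (fun i => (W (C.enc k i)).1) * C.dec k).trace.re
      ≤ (L ^ n) ^ (1 / α) * (T * C.dec k).trace.re ^ ((α - 1) / α) := fun k => by
    refine (trace_mul_effect_le hα (piTensor_posSemidef fun i => (W _).2.1)
      (C.dec_posSemidef k) (dec_le_one C k) hT).trans ?_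
    have hQ0 : ∀ i, 0 ≤ sandwichedQPosDef α (W (C.enc k i)).1 τ := fun i =>
      sandwichedQPosDef_nonneg α hτ.posSemidef
    rw [hTdef, sandwichedQPosDef_piTensor α (fun i => (W (C.enc k i)).2.1)
      fun _ => hτ.posSemidef]
    have hprod : ∏ i, sandwichedQPosDef α (W (C.enc k i)).1 τ ≤ L ^ n := by
      refine (Finset.prod_le_prod (fun i _ => hQ0 i) fun i _ => hL _).trans_eq ?_
      simp
    have h0 := Finset.prod_nonneg fun i (_ : i ∈ Finset.univ) => hQ0 i
    have h1 := ht0 k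
    rw [hTdef] at h1
    gcongr
  rw [successProb_eq]
  have hhold : ∑ k, (T * C.dec k).trace.re ^ ((α - 1) / α)
      ≤ (C.card : ℝ) ^ (1 / α) * (τ.trace.re ^ n) ^ ((α - 1) / α) := by
    have h := Real.inner_le_Lp_mul_Lq_of_nonneg Finset.univ hconj
      (f := fun _ : Fin C.card => 1) (g := fun k => (T * C.dec k).trace.re ^ ((α - 1) / α))
      (fun _ _ => zero_le_one) (fun k _ => Real.rpow_nonneg (ht0 k) _)
    have he : (α - 1) / α * (α / (α - 1)) = 1 := by field_simp
    simp only [one_mul, Real.one_rpow, ← Real.rpow_mul (ht0 _), he, Real.rpow_one, hsum,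
      Finset.sum_const, Finset.card_univ, Fintype.card_fin, nsmul_eq_mul, mul_one,
      one_div_div] at h
    exact h
  have htr0 : 0 ≤ τ.trace.re ^ n := pow_nonneg (posSemidef_trace_re_nonneg hτ.posSemidef) n
  -- For `n = 0` nothing forces `L` to be nonnegative, but then the power is `1`.
  have hLn : ∀ k : Fin C.card, 0 ≤ (L ^ n) ^ (1 / α) := fun k => by
    rcases n.eq_zero_or_pos with hn | hn
    · subst hn; simp
    · have : 0 ≤ L := (sandwichedQPosDef_nonneg α hτ.posSemidef).trans (hL (C.enc k ⟨0, hn⟩))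
      positivity
  have hL0 := hLn ⟨0, C.card_pos⟩
  calc (1 / (C.card : ℝ)) * ∑ k, (piTensor (fun i => (W (C.enc k i)).1) * C.dec k).trace.re
      ≤ (1 / (C.card : ℝ)) * ∑ k, (L ^ n) ^ (1 / α) * (T * C.dec k).trace.re ^ ((α - 1) / α) := by
        gcongr with k
        exact hk k
    _ ≤ (1 / (C.card : ℝ)) * ((L ^ n) ^ (1 / α)
          * ((C.card : ℝ) ^ (1 / α) * (τ.trace.re ^ n) ^ ((α - 1) / α))) := by
        rw [← Finset.mul_sum]
        gcongr
    _ = _ := by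
        have : (1 / (C.card : ℝ)) * (C.card : ℝ) ^ (1 / α)
            = ((C.card : ℝ) ^ ((α - 1) / α))⁻¹ := by
          rw [← Real.rpow_neg hM.le, one_div, ← Real.rpow_neg_one, ← Real.rpow_add hM]
          congr 1
          field_simp
          ring
        rw [Real.div_rpow htr0 hM.le, div_eq_mul_inv _ ((C.card : ℝ) ^ _), ← this]
        ring

lemma trace_add_smul_one (σ : DensityOp d) (δ : ℝ) :
    (σ.1 + δ • (1 : Matrix d d ℂ)).trace.re = 1 + δ * Fintype.card d := by
  rw [trace_add, trace_smul, σ.2.2, trace_one]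
  simp

lemma log_successProb_le (hα : 1 < α) (W : Channel X d) {σ : DensityOp d} {c δ : ℝ} (hδ : 0 < δ)
    (hσ : ∀ x, sandwichedQPosDef α (W x).1 (σ.1 + δ • 1) ≤ Real.exp ((α - 1) * c))
    {n : ℕ} (hn : 0 < n) (C : Code X d n) (hP : 0 < successProb W C) :
    (1 / (n : ℝ)) * Real.log (successProb W C)
      ≤ (α - 1) / α * (c + δ * Fintype.card d - (1 / (n : ℝ)) * Real.log C.card) := by
  have hα0 : 0 < α := by linarith
  have hp : 0 ≤ (α - 1) / α := div_nonneg (by linarith) hα0.le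
  have hn' : (0 : ℝ) < n := by exact_mod_cast hn
  have hM : (0 : ℝ) < C.card := by exact_mod_cast C.card_pos
  have h := successProb_le hα W (posDef_add_smul_one σ.2.1 hδ) hσ C
  rw [trace_add_smul_one] at h
  have ht : 0 < 1 + δ * (Fintype.card d : ℝ) := by positivity
  have hlog := Real.log_le_log hP h
  rw [Real.log_mul (by positivity) (by positivity), Real.log_rpow (by positivity),
    Real.log_rpow (by positivity), Real.log_div (by positivity) hM.ne', Real.log_pow,
    Real.log_pow, Real.log_exp] at hlog
  have hl1 : Real.log (1 + δ * Fintype.card d) ≤ δ * Fintype.card d := by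
    have := Real.log_le_sub_one_of_pos ht
    linarith
  calc (1 / (n : ℝ)) * Real.log (successProb W C)
      ≤ (1 / (n : ℝ)) * (1 / α * (n * ((α - 1) * c)) + (α - 1) / α
          * (n * Real.log (1 + δ * Fintype.card d) - Real.log C.card)) := by gcongr
    _ = (α - 1) / α * (c + Real.log (1 + δ * Fintype.card d)
          - (1 / (n : ℝ)) * Real.log C.card) := by field_simp; ring
    _ ≤ _ := by gcongr

/-- The strong converse bound with the capacity replaced by a real number above it. -/
lemma le_of_isAchievable (hα : 1 < α) (W : Channel X d) {R r c : ℝ} (h : IsAchievable W R r)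
    (hc : renyiCapacity α W < c) : (α - 1) / α * (R - c) ≤ r := by
  obtain ⟨C, hR, hr⟩ := h
  have : Nonempty X := ⟨(C 1).enc ⟨0, (C 1).card_pos⟩ 0⟩
  have hp : 0 ≤ (α - 1) / α := div_nonneg (by linarith) (by linarith)
  set p := (α - 1) / α with hpdef
  set K : ℝ := 1 + p + p * Fintype.card d with hK
  have hKpos : 0 < K := by positivity
  -- Rate, exponent and regularization are all allowed a slack `δ`.
  have key : ∀ δ : ℝ, 0 < δ → p * (R - c) ≤ r + δ * K := by
    intro δ hδ
    obtain ⟨σ, hσ⟩ := exists_forall_sandwichedQPosDef_le hα W hc hδ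
    have hR' : ((R - δ : ℝ) : EReal) < (R : EReal) := by exact_mod_cast sub_lt_self R hδ
    have hr' : ((-r - δ : ℝ) : EReal) < ((-r : ℝ) : EReal) := by exact_mod_cast sub_lt_self _ hδ
    obtain ⟨n, h1, h2, hn⟩ := ((eventually_lt_of_lt_liminf (hR'.trans_le hR)).and
      ((eventually_lt_of_lt_liminf (hr'.trans_le hr)).and (eventually_gt_atTop 0))).exists
    have hn' : (0 : ℝ) < n := by exact_mod_cast hn
    have hM : (0 : ℝ) < (C n).card := by exact_mod_cast (C n).card_pos
    have hP : 0 < successProb W (C n) := by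
      by_contra hcon
      rw [ENNReal.ofReal_eq_zero.mpr (not_lt.mp hcon), ENNReal.log_zero,
        EReal.coe_mul_bot_of_pos (by positivity)] at h2
      exact not_lt_bot h2
    rw [← ENNReal.ofReal_natCast, ENNReal.log_ofReal_of_pos hM, ← EReal.coe_mul,
      EReal.coe_lt_coe_iff] at h1
    rw [ENNReal.log_ofReal_of_pos hP, ← EReal.coe_mul, EReal.coe_lt_coe_iff] at h2
    have h3 := log_successProb_le hα W hδ hσ hn (C n) hP
    have h4 : p * (c + δ * Fintype.card d - 1 / (n : ℝ) * Real.log (C n).card)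
        ≤ p * (c + δ * Fintype.card d - (R - δ)) := by gcongr
    have h5 := (h2.trans_le h3).trans_le h4
    rw [hK]
    linarith
  refine le_of_forall_pos_le_add fun ε hε => ?_
  have := key (ε / K) (div_pos hε hKpos)
  rwa [div_mul_cancel₀ _ hKpos.ne'] at this

end Coding

end CQ

theorem mainTheorem2 {X d : Type*} [Fintype d] [DecidableEq d] (W : CQ.Channel X d)
    (R : ℝ) (hR : 0 ≤ R) :
    (⨆ (α : ℝ) (_ : 1 < α),
        (((α - 1) / α : ℝ) : EReal) * ((R : EReal) - CQ.renyiCapacity α W))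
      ≤ CQ.strongConverseExponent R W := by
  refine iSup₂_le fun α hα => le_iInf₂ fun r hr => ?_
  have hp : 0 < (α - 1) / α := div_pos (by linarith) (by linarith)
  have hp' : (0 : EReal) ≤ (((α - 1) / α : ℝ) : EReal) := by exact_mod_cast hp.le
  -- Every real `c` above the capacity satisfies the finite trade-off, so the capacity is at least
  -- `R - r / p` with `p = (α - 1) / α`.
  have hcap : ((R - r / ((α - 1) / α) : ℝ) : EReal) ≤ CQ.renyiCapacity α W := by
    refine EReal.le_of_forall_lt_iff_le.mp fun c hc => ?_
    have h := CQ.le_of_isAchievable hα W hr hc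
    rw [mul_comm, ← le_div_iff₀ hp] at h
    exact_mod_cast (by linarith : R - r / ((α - 1) / α) ≤ c)
  calc (((α - 1) / α : ℝ) : EReal) * ((R : EReal) - CQ.renyiCapacity α W)
      ≤ (((α - 1) / α : ℝ) : EReal)
        * ((R : EReal) - ((R - r / ((α - 1) / α) : ℝ) : EReal)) :=
        mul_le_mul_of_nonneg_left (EReal.sub_le_sub le_rfl hcap) hp'
    _ = (r : EReal) := by
        rw [← EReal.coe_sub, ← EReal.coe_mul, sub_sub_cancel, mul_div_cancel₀ _ hp.ne']
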